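/- Let $\mathbb K$ be any field. For a finite simplicial complex $X$ write $\widetilde\beta(X)=\sum_{i\ge -1}\dim_{\mathbb K}\widetilde H_i(X;\mathbb K)$ for its total reduced Betti number over $\mathbb K$ (the empty set counts as a face of dimension $-1$), and for a finite simple graph $G$ let $\widetilde b(G)=\widetilde\beta(\mathrm{Ind}(G))$, where $\mathrm{Ind}(G)$ is the independence complex of $G$, whose faces are the independent sets of $G$. For $d\ge 1$ put $\Theta_d=d^{1/(d+1)}$, so that $\Theta_2=2^{1/3}$. Let $G$ be a finite simple graph with $n\ge 0$ vertices and without an induced copy of the complete graph $K_4$. Then $$\widetilde b(G)\le \Theta_2^{\,n}=2^{n/3}.$$ If, in addition, $G$ contains a vertex of degree at most $3$ whose connected component is not a single triangle, then $$\widetilde b(G)\le\left(\Theta_2^{-4}+\Theta_2^{-5}+\Theta_2^{-6}\right)\Theta_2^{\,n}.$$ Consequently, let $I_4$ denote the graph with $4$ vertices and no edges, and for $n\ge 0$ let $b_{I_4}(n)$ be the maximum of $\widetilde\beta(\mathrm{cl}(G))$ over all simple graphs $G$ with at most $n$ vertices and without an induced copy of $I_4$, where $\mathrm{cl}(G)$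 is the clique complex of $G$, whose faces are the cliques of $G$. Then $$b_{I_4}(n)\le 2^{n/3}\qquad\text{for every } n\ge 0.$$ -/

import Mathlib

universe u v

noncomputable section

namespace SimpleGraph

/-- The independence complex of `G`: its faces are the nonempty finite independent sets. -/
def indepComplex {V : Type u} (G : SimpleGraph V) : AbstractSimplicialComplex V where
  faces := {s | s.Nonempty ∧ G.IsIndepSet (s : Set V)}
  isRelLowerSet_faces := fun _ hs =>
    ⟨hs.1, fun _ hts ht => ⟨ht, Set.Pairwise.mono (Finset.coe_subset.mpr hts) hs.2⟩⟩
  singleton_mem := fun w => ⟨Finset.singleton_nonempty w, by simp⟩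

/-- The clique complex of `G`: its faces are the nonempty finite cliques. -/
def cliqueComplex {V : Type u} (G : SimpleGraph V) : AbstractSimplicialComplex V where
  faces := {s | s.Nonempty ∧ G.IsClique (s : Set V)}
  isRelLowerSet_faces := fun _ hs =>
    ⟨hs.1, fun _ hts ht => ⟨ht, Set.Pairwise.mono (Finset.coe_subset.mpr hts) hs.2⟩⟩
  singleton_mem := fun w => ⟨Finset.singleton_nonempty w, by simp⟩

end SimpleGraph

/-- The simplicial boundary operator on formal linear combinations of vertex sets (a combination is
given by its coefficients). If
`v₀ < v₁ < ⋯ < vₘ` are the elements of `s` then `∂ s = ∑ i, (-1) ^ i • (s \ {vᵢ})`. In particular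
`∂ {v} = ∅` (the augmentation) and `∂ ∅ = 0`. The order of the vertices only serves to orient the
simplices: up to isomorphism, homology does not depend on it. -/
def simplicialBoundary (𝕜 : Type v) [Field 𝕜] (V : Type u) [Fintype V]
    [LinearOrder V] : (Finset V → 𝕜) →ₗ[𝕜] (Finset V → 𝕜) :=
  Fintype.linearCombination 𝕜 fun s : Finset V =>
    ∑ v ∈ s, Pi.single (s.erase v) ((-1 : 𝕜) ^ (s.filter (· < v)).card)

namespace AbstractSimplicialComplex

variable (𝕜 : Type v) [Field 𝕜] {V : Type u} [Fintype V] [LinearOrder V]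

/-- The augmented chains of `X` spanned by the faces with exactly `j` vertices, that is, the chains
of dimension `j - 1`. The empty set counts as the face of dimension `-1`. -/
def reducedChains (X : AbstractSimplicialComplex V) (j : ℕ) : Submodule 𝕜 (Finset V → 𝕜) :=
  Pi.spanSubset 𝕜 {s : Finset V | (s = ∅ ∨ s ∈ X.faces) ∧ s.card = j}

/-- The reduced cycles of dimension `j - 1`. -/
def reducedCycles (X : AbstractSimplicialComplex V) (j : ℕ) : Submodule 𝕜 (Finset V → 𝕜) :=
  X.reducedChains 𝕜 j ⊓ LinearMap.ker (simplicialBoundary 𝕜 V)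

/-- The reduced boundaries of dimension `j - 1`. -/
def reducedBoundaries (X : AbstractSimplicialComplex V) (j : ℕ) : Submodule 𝕜 (Finset V → 𝕜) :=
  (X.reducedChains 𝕜 (j + 1)).map (simplicialBoundary 𝕜 V)

/-- The reduced simplicial homology of `X` with coefficients in `𝕜`, in dimension `j - 1`. -/
abbrev ReducedHomology (X : AbstractSimplicialComplex V) (j : ℕ) : Type (max u v) :=
  ↥(X.reducedCycles 𝕜 j) ⧸ (X.reducedBoundaries 𝕜 j).submoduleOf (X.reducedCycles 𝕜 j)

/-- The total reduced Betti number `∑_{i ≥ -1} dim H̃ᵢ(X; 𝕜)` of a complex on a finite vertex set.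
The summand with index `j` is the one of dimension `i = j - 1`; it vanishes if `j > |V|`. -/
def totalReducedBetti (X : AbstractSimplicialComplex V) : ℕ :=
  ∑ j ∈ Finset.range (Fintype.card V + 1), Module.finrank 𝕜 (X.ReducedHomology 𝕜 j)

end AbstractSimplicialComplex

namespace SimpleGraph

/-- `b̃(G)`: the total reduced Betti number of the independence complex of `G`. -/
def indepBetti (𝕜 : Type v) [Field 𝕜] {V : Type u} [Fintype V] [LinearOrder V]
    (G : SimpleGraph V) : ℕ :=
  G.indepComplex.totalReducedBetti 𝕜

open Classical in
/-- `b_H(n)`: the maximum of the total reduced Betti number of the clique complex of `G` over all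
graphs `G` on at most `n` vertices that have no induced subgraph isomorphic to `H`. -/
def maxCliqueBetti (𝕜 : Type v) [Field 𝕜] {W : Type u} (H : SimpleGraph W) (n : ℕ) : ℕ :=
  ((Finset.univ : Finset ((m : Fin (n + 1)) × SimpleGraph (Fin m))).filter
    fun G => ¬ H ⊴ G.2).sup fun G => G.2.cliqueComplex.totalReducedBetti 𝕜

/-- The connected component of `v` in `G` consists of a single triangle. -/
def InTriangleComponent {V : Type u} (G : SimpleGraph V) (v : V) : Prop :=
  Nonempty ((G.connectedComponentMk v).toSimpleGraph ≃g (⊤ : SimpleGraph (Fin 3)))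

end SimpleGraph

/-- `Θ_d = d ^ (1 / (d + 1))`. -/
def bigTheta (d : ℕ) : ℝ := (d : ℝ) ^ (1 / ((d : ℝ) + 1))

end

/-! Put x = Θ₂⁻¹, so that x³ = 1/2. The topology enters only through three properties of f(S) =
b̃(G[S]), collected in `IsBranching`: f(∅) ≤ 1; f(S) ≤ 0 if G[S] has an isolated vertex, because the
complex is a cone; and f(S) ≤ f(S − u) + f(S − N[u]), because the boundary operator is block
triangular with respect to the deletion and the link of u.

Deleting the neighbours u₁, …, u_d of a vertex v in turn isolates v, so f(S) is at most the sum of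
the values f(S − {u₁, …, u_{i−1}} − N[u_i]) (`IsBranching.le_branchSum`). The i-th term loses u_i,
its neighbours, and every earlier u_j not adjacent to u_i. If k vertices are lost, induction bounds
the term by x^k M, where M = Θ₂^|S|. It remains to choose v and the order of its neighbours so that
the powers of x add up to at most 1. As G has no K₄, the link of v (the graph induced on its
neighbours) is triangle-free, which leaves few cases.

Where the plain count falls short, some vertex left in a term has lost most of its neighbours. The
term then improves by the second bound of the theorem, proved in the same induction, or by its
variants for degree at most 1 and 2 (`Step.bound_leaf`, `Step.bound_deg_two`). The obstruction is a
triangle component; the exact degrees then force a K₄, a vertex of too small degree, or another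
improvement.

The cases: degree at most 3 (`Step.le_of_low`, or a triangle component, where 2x³ = 1); degree at
least 6, where x + x⁷ < 1; degree 4 (`Step.le_of_degOn_four`); and 5-regular graphs
(`Step.le_of_regular_five`). The clique statement follows by passing to complements.

Below, "exponents 4, 5, 6" lists the k of the successive terms, in the order in which the neighbours
are deleted. -/

namespace SimplicialBoundary

open Finset

/-! ### The rank of the boundary operator: deletion, link and cone -/

section LinearAlgebra

variable {𝕜 : Type*} [Field 𝕜] {M N : Type*} [AddCommGroup M] [Module 𝕜 M] [AddCommGroup N]
  [Module 𝕜 N] [FiniteDimensional 𝕜 M]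

/-- Rank–nullity for π restricted to R, whose kernel contains A. It yields the superadditivity of
rank for block triangular operators. -/
theorem finrank_add_finrank_le_of_le_ker (π : M →ₗ[𝕜] N) {A R : Submodule 𝕜 M} (hA : A ≤ R)
    (hker : A ≤ LinearMap.ker π) :
    Module.finrank 𝕜 A + Module.finrank 𝕜 (R.map π) ≤ Module.finrank 𝕜 R := by
  have h := (π.domRestrict R).finrank_range_add_finrank_ker
  have hle : Module.finrank 𝕜 A ≤ Module.finrank 𝕜 (LinearMap.ker (π.domRestrict R)) := by
    let g : A →ₗ[𝕜] LinearMap.ker (π.domRestrict R) :=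
      LinearMap.codRestrict _ (Submodule.inclusion hA) fun a => by
        simpa using hker a.2
    refine LinearMap.finrank_le_finrank_of_injective (f := g) ?_
    intro a b hab
    have := congrArg (fun z => (z.1 : M)) hab
    exact Subtype.ext this
  rw [LinearMap.range_domRestrict] at h
  omega

theorem spanSubset_mono {ι : Type*} [Finite ι] {K L : Set ι} (h : K ⊆ L) :
    Pi.spanSubset 𝕜 K ≤ Pi.spanSubset 𝕜 L :=
  Submodule.span_mono (Set.image_mono h)

end LinearAlgebra

variable {𝕜 : Type v} [Field 𝕜] {V : Type u} [LinearOrder V]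

/-- The cancellation behind ∂² = 0: removing v lowers the position of the larger vertex w by one,
while removing w does not move v. -/
theorem sign_erase_swap {s : Finset V} {v w : V} (hv : v ∈ s) (h : v < w) :
    (-1 : 𝕜) ^ (s.filter (· < v)).card * (-1) ^ ((s.erase v).filter (· < w)).card +
      (-1) ^ (s.filter (· < w)).card * (-1) ^ ((s.erase w).filter (· < v)).card = 0 := by
  have h1 : (s.erase w).filter (· < v) = s.filter (· < v) := by
    ext x
    simp only [mem_filter, mem_erase]
    constructor
    · rintro ⟨⟨_, hx⟩, hxv⟩
      exact ⟨hx, hxv⟩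
    · rintro ⟨hx, hxv⟩
      exact ⟨⟨(hxv.trans h).ne, hx⟩, hxv⟩
  have h2 : (s.erase v).filter (· < w) = (s.filter (· < w)).erase v := by
    rw [filter_erase]
  have h3 : ((s.filter (· < w)).erase v).card + 1 = (s.filter (· < w)).card :=
    card_erase_add_one (by simp [hv, h])
  rw [h1, h2, ← h3, pow_succ]
  ring

/-- Extend a chain to the cone with apex `u`, without signs. -/
def coneMap (𝕜 : Type v) [Field 𝕜] (u : V) : (Finset V → 𝕜) →ₗ[𝕜] (Finset V → 𝕜) where
  toFun x s := if u ∈ s then x (s.erase u) else 0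
  map_add' x y := by ext s; by_cases h : u ∈ s <;> simp [h]
  map_smul' c x := by ext s; by_cases h : u ∈ s <;> simp [h]

/-- The coefficients of a chain at the simplices that contain `u`. -/
def linkMap (𝕜 : Type v) [Field 𝕜] (u : V) : (Finset V → 𝕜) →ₗ[𝕜] (Finset V → 𝕜) where
  toFun x t := if u ∈ t then 0 else x (insert u t)
  map_add' x y := by ext s; by_cases h : u ∈ s <;> simp [h]
  map_smul' c x := by ext s; by_cases h : u ∈ s <;> simp [h]

/-- The coefficients of a chain at the simplices that do not contain `u`. -/
def deletionMap (𝕜 : Type v) [Field 𝕜] (u : V) : (Finset V → 𝕜) →ₗ[𝕜] (Finset V → 𝕜) where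
  toFun x t := if u ∈ t then 0 else x t
  map_add' x y := by ext s; by_cases h : u ∈ s <;> simp [h]
  map_smul' c x := by ext s; by_cases h : u ∈ s <;> simp [h]

/-- The diagonal map with entries `(-1) ^ m`, where `m` vertices of the simplex are above `u`. -/
def twist (𝕜 : Type v) [Field 𝕜] (u : V) : (Finset V → 𝕜) →ₗ[𝕜] (Finset V → 𝕜) where
  toFun x t := (-1 : 𝕜) ^ (t.filter (u < ·)).card * x t
  map_add' x y := by ext s; simp [mul_add]
  map_smul' c x := by ext s; simp [mul_left_comm]

/-- The diagonal map with entries `(-1) ^ m`, where `m` vertices of the simplex are below `u`. -/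
def lowerTwist (𝕜 : Type v) [Field 𝕜] (u : V) : (Finset V → 𝕜) →ₗ[𝕜] (Finset V → 𝕜) where
  toFun x t := (-1 : 𝕜) ^ (t.filter (· < u)).card * x t
  map_add' x y := by ext s; simp [mul_add]
  map_smul' c x := by ext s; simp [mul_left_comm]

theorem coneMap_single {u : V} {t : Finset V} (h : u ∉ t) (c : 𝕜) :
    coneMap 𝕜 u (Pi.single t c) = Pi.single (insert u t) c := by
  ext s
  simp only [coneMap, LinearMap.coe_mk, AddHom.coe_mk, Pi.single_apply]
  by_cases hs : u ∈ s
  · have : s.erase u = t ↔ s = insert u t := by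
      constructor
      · rintro rfl; exact (insert_erase hs).symm
      · rintro rfl; exact erase_insert h
    simp [hs, this]
  · have : s ≠ insert u t := by rintro rfl; simp at hs
    simp [hs, this]

theorem linkMap_single_insert {u : V} {t : Finset V} (h : u ∉ t) (c : 𝕜) :
    linkMap 𝕜 u (Pi.single (insert u t) c) = Pi.single t c := by
  ext s
  simp only [linkMap, LinearMap.coe_mk, AddHom.coe_mk, Pi.single_apply]
  by_cases hs : u ∈ s
  · have : s ≠ t := by rintro rfl; exact h hs
    simp [hs, this]
  · have : insert u s = insert u t ↔ s = t :=
      ⟨fun e => by rw [← erase_insert hs, e, erase_insert h], fun e => by rw [e]⟩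
    simp [hs, this]

theorem linkMap_single_of_notMem {u : V} {t : Finset V} (h : u ∉ t) (c : 𝕜) :
    linkMap 𝕜 u (Pi.single t c) = 0 := by
  ext s
  have : insert u s ≠ t := by rintro rfl; simp at h
  simp [linkMap, this]

theorem deletionMap_single_of_notMem {u : V} {t : Finset V} (h : u ∉ t) (c : 𝕜) :
    deletionMap 𝕜 u (Pi.single t c) = Pi.single t c := by
  ext s
  simp only [deletionMap, LinearMap.coe_mk, AddHom.coe_mk, Pi.single_apply]
  by_cases hs : u ∈ s
  · have : s ≠ t := by rintro rfl; exact h hs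
    simp [hs, this]
  · simp [hs]

theorem deletionMap_single_of_mem {u : V} {t : Finset V} (h : u ∈ t) (c : 𝕜) :
    deletionMap 𝕜 u (Pi.single t c) = 0 := by
  ext s
  simp only [deletionMap, LinearMap.coe_mk, AddHom.coe_mk, Pi.single_apply]
  by_cases hs : u ∈ s
  · simp [hs]
  · have : s ≠ t := by rintro rfl; exact hs h
    simp [hs, this]

theorem twist_single (u : V) (t : Finset V) (c : 𝕜) :
    twist 𝕜 u (Pi.single t c) = Pi.single t ((-1 : 𝕜) ^ (t.filter (u < ·)).card * c) := by
  ext s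
  by_cases h : s = t
  · subst h; simp [twist]
  · simp [twist, h]

theorem lowerTwist_single (u : V) (t : Finset V) (c : 𝕜) :
    lowerTwist 𝕜 u (Pi.single t c) = Pi.single t ((-1 : 𝕜) ^ (t.filter (· < u)).card * c) := by
  ext s
  by_cases h : s = t
  · subst h; simp [lowerTwist]
  · simp [lowerTwist, h]

theorem twist_twist (u : V) (x : Finset V → 𝕜) : twist 𝕜 u (twist 𝕜 u x) = x := by
  ext t
  simp only [twist, LinearMap.coe_mk, AddHom.coe_mk]
  rw [← mul_assoc, ← mul_pow]; simp

theorem lowerTwist_lowerTwist (u : V) (x : Finset V → 𝕜) :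
    lowerTwist 𝕜 u (lowerTwist 𝕜 u x) = x := by
  ext t
  simp only [lowerTwist, LinearMap.coe_mk, AddHom.coe_mk]
  rw [← mul_assoc, ← mul_pow]; simp

variable [Fintype V]

theorem apply_single (s : Finset V) :
    simplicialBoundary 𝕜 V (Pi.single s 1) =
      ∑ v ∈ s, Pi.single (s.erase v) ((-1 : 𝕜) ^ (s.filter (· < v)).card) := by
  simp [simplicialBoundary, Fintype.linearCombination_apply_single]

theorem apply_apply_single (s : Finset V) :
    simplicialBoundary 𝕜 V (simplicialBoundary 𝕜 V (Pi.single s 1)) = 0 := by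
  have key : ∀ (t : Finset V) (c : 𝕜), simplicialBoundary 𝕜 V (Pi.single t c) =
      ∑ v ∈ t, Pi.single (t.erase v) (c * (-1 : 𝕜) ^ (t.filter (· < v)).card) := by
    intro t c
    have : (Pi.single t c : Finset V → 𝕜) = c • Pi.single t 1 := by
      rw [← Pi.single_smul]; simp
    rw [this, map_smul, apply_single, smul_sum]
    refine sum_congr rfl fun v _ => ?_
    rw [← Pi.single_smul]; simp
  rw [apply_single, map_sum]
  simp_rw [key]
  rw [sum_sigma']
  refine sum_involution (fun a _ => ⟨a.2, a.1⟩) ?_ ?_ ?_ ?_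
  · rintro ⟨v, w⟩ h
    simp only [mem_sigma, mem_erase] at h
    rw [show (s.erase w).erase v = (s.erase v).erase w from erase_right_comm, ← Pi.single_add]
    rcases lt_or_gt_of_ne h.2.1 with h' | h'
    · rw [add_comm, sign_erase_swap h.2.2 h', Pi.single_zero]
    · rw [sign_erase_swap h.1 h', Pi.single_zero]
  · rintro ⟨v, w⟩ h _
    simp only [mem_sigma, mem_erase] at h
    intro h'
    exact h.2.1 (congrArg Sigma.fst h')
  · rintro ⟨v, w⟩ h
    simp only [mem_sigma, mem_erase] at h ⊢
    exact ⟨h.2.2, h.2.1.symm, h.1⟩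
  · rintro ⟨v, w⟩ h
    rfl

theorem apply_apply (x : Finset V → 𝕜) :
    simplicialBoundary 𝕜 V (simplicialBoundary 𝕜 V x) = 0 := by
  have : simplicialBoundary 𝕜 V ∘ₗ simplicialBoundary 𝕜 V = 0 := by
    refine (Pi.basisFun 𝕜 (Finset V)).ext fun s => ?_
    simpa using apply_apply_single s
  exact LinearMap.congr_fun this x

/-- Adding u to t flips the sign of the face at w exactly when u < w. Hence the link block of ∂ is
−1 on those faces relative to ∂ itself, which is conjugation by the diagonal sign `twist`; its rank
is unchanged. -/
theorem linkMap_boundary_cone_single {u : V} {t : Finset V} (h : u ∉ t) :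
    linkMap 𝕜 u (simplicialBoundary 𝕜 V (coneMap 𝕜 u (Pi.single t 1))) =
      twist 𝕜 u (simplicialBoundary 𝕜 V (twist 𝕜 u (Pi.single t 1))) := by
  have hone : ∀ c : 𝕜, (Pi.single t c : Finset V → 𝕜) = c • Pi.single t 1 := by
    intro c; rw [← Pi.single_smul]; simp
  rw [coneMap_single h, apply_single, sum_insert h, map_add, erase_insert h,
    linkMap_single_of_notMem h, zero_add, twist_single, hone, map_smul, apply_single, map_smul,
    map_sum, map_sum, smul_sum]
  refine sum_congr rfl fun w hw => ?_
  have hwu : w ≠ u := by rintro rfl; exact h hw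
  rw [erase_insert_of_ne hwu.symm, linkMap_single_insert (by simp [h]), twist_single,
    ← Pi.single_smul]
  congr 1
  rw [filter_insert, filter_erase]
  by_cases hlt : u < w
  · rw [if_pos hlt, card_insert_of_notMem (by simp [h])]
    have h3 := card_erase_add_one (s := t.filter (u < ·)) (a := w) (by simp [hw, hlt])
    rw [← h3]
    simp only [smul_eq_mul, mul_one]
    have h4 : ((-1 : 𝕜) ^ ((t.filter (u < ·)).erase w).card) *
        (-1) ^ ((t.filter (u < ·)).erase w).card = 1 := by
      rw [← mul_pow]; simp
    rw [pow_succ, pow_succ]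
    linear_combination ((-1 : 𝕜) ^ (t.filter (· < w)).card) * h4
  · rw [if_neg hlt, erase_eq_of_notMem (by simp [hlt])]
    have h4 : ((-1 : 𝕜) ^ (t.filter (u < ·)).card) * (-1) ^ (t.filter (u < ·)).card = 1 := by
      rw [← mul_pow]; simp
    simp only [smul_eq_mul, mul_one]
    linear_combination (-(-1 : 𝕜) ^ (t.filter (· < w)).card) * h4

/-- The only facet of `insert u t` that avoids u is t, so this block of ∂ is diagonal with entries
±1. -/
theorem deletionMap_boundary_cone_single {u : V} {t : Finset V} (h : u ∉ t) :
    deletionMap 𝕜 u (simplicialBoundary 𝕜 V (coneMap 𝕜 u (Pi.single t 1))) =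
      lowerTwist 𝕜 u (Pi.single t 1) := by
  rw [coneMap_single h, apply_single, sum_insert h, map_add, erase_insert h,
    deletionMap_single_of_notMem h, map_sum, sum_eq_zero, add_zero, lowerTwist_single, filter_insert,
    if_neg (lt_irrefl u), mul_one]
  intro w hw
  have hwu : w ≠ u := by rintro rfl; exact h hw
  exact deletionMap_single_of_mem (by simp [hwu.symm]) _

theorem map_spanSubset_congr {K : Set (Finset V)} {φ ψ : (Finset V → 𝕜) →ₗ[𝕜] (Finset V → 𝕜)}
    (h : ∀ t ∈ K, φ (Pi.single t 1) = ψ (Pi.single t 1)) :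
    (Pi.spanSubset 𝕜 K).map φ = (Pi.spanSubset 𝕜 K).map ψ := by
  rw [Pi.spanSubset, Submodule.map_span, Submodule.map_span]
  congr 1
  ext x
  simp only [Set.mem_image, exists_exists_and_eq_and, Pi.basisFun_apply]
  constructor <;> rintro ⟨t, ht, rfl⟩ <;> exact ⟨t, ht, by rw [h t ht]⟩

theorem map_twist_spanSubset (u : V) (K : Set (Finset V)) :
    (Pi.spanSubset 𝕜 K).map (twist 𝕜 u) = Pi.spanSubset 𝕜 K := by
  have hle : (Pi.spanSubset 𝕜 K).map (twist 𝕜 u) ≤ Pi.spanSubset 𝕜 K := by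
    rintro _ ⟨x, hx, rfl⟩
    rw [Pi.mem_spanSubset_iff]
    intro i hi
    simp [twist, Pi.mem_spanSubset_iff.1 hx i hi]
  refine le_antisymm hle fun x hx => ⟨twist 𝕜 u x, hle ⟨x, hx, rfl⟩, twist_twist u x⟩

theorem map_spanSubset_le {K L : Set (Finset V)} {φ : (Finset V → 𝕜) →ₗ[𝕜] (Finset V → 𝕜)}
    (h : ∀ t ∈ K, φ (Pi.single t 1) ∈ Pi.spanSubset 𝕜 L) :
    (Pi.spanSubset 𝕜 K).map φ ≤ Pi.spanSubset 𝕜 L := by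
  conv_lhs => rw [Pi.spanSubset]
  rw [Submodule.map_span, Submodule.span_le]
  rintro _ ⟨_, ⟨t, ht, rfl⟩, rfl⟩
  simpa using h t ht

theorem single_mem_spanSubset {K : Set (Finset V)} {t : Finset V} (h : t ∈ K) (c : 𝕜) :
    Pi.single t c ∈ Pi.spanSubset 𝕜 K := by
  rw [Pi.mem_spanSubset_iff]
  intro i hi
  have : i ≠ t := by rintro rfl; exact hi h
  simp [this]

/-- The rank of the boundary operator on the chains supported on a family of simplices. -/
noncomputable def rankOn (𝕜 : Type v) [Field 𝕜] (K : Set (Finset V)) : ℕ :=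
  Module.finrank 𝕜 ((Pi.spanSubset 𝕜 K).map (simplicialBoundary 𝕜 V))

theorem rankOn_mono {K L : Set (Finset V)} (h : K ⊆ L) : rankOn 𝕜 K ≤ rankOn 𝕜 L :=
  Submodule.finrank_mono (Submodule.map_mono (spanSubset_mono h))

theorem rankOn_empty : rankOn 𝕜 (∅ : Set (Finset V)) = 0 := by
  rw [rankOn, Pi.spanSubset, Set.image_empty, Submodule.span_empty, Submodule.map_bot,
    finrank_bot]

/-- The boundary operator is block triangular with respect to the deletion and the link of `u`. -/
theorem rankOn_deletion_add_rankOn_link_le (K : Set (Finset V)) (u : V) :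
    rankOn 𝕜 {s | s ∈ K ∧ u ∉ s} + rankOn 𝕜 {t | u ∉ t ∧ insert u t ∈ K} ≤ rankOn 𝕜 K := by
  set R := (Pi.spanSubset 𝕜 K).map (simplicialBoundary 𝕜 V)
  have h1 := finrank_add_finrank_le_of_le_ker (linkMap 𝕜 u)
    (A := (Pi.spanSubset 𝕜 {s | s ∈ K ∧ u ∉ s}).map (simplicialBoundary 𝕜 V)) (R := R)
    (Submodule.map_mono (spanSubset_mono fun s hs => hs.1)) (by
      rw [Pi.spanSubset, Submodule.map_span, Submodule.span_le]
      rintro _ ⟨_, ⟨t, ht, rfl⟩, rfl⟩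
      simp only [Pi.basisFun_apply, SetLike.mem_coe, LinearMap.mem_ker, apply_single, map_sum]
      exact sum_eq_zero fun w _ => linkMap_single_of_notMem (by simp [ht.2]) _)
  have h2 : ((Pi.spanSubset 𝕜 {t | u ∉ t ∧ insert u t ∈ K}).map
      (twist 𝕜 u ∘ₗ simplicialBoundary 𝕜 V ∘ₗ twist 𝕜 u)) ≤ R.map (linkMap 𝕜 u) := by
    rw [← map_spanSubset_congr
      (φ := linkMap 𝕜 u ∘ₗ simplicialBoundary 𝕜 V ∘ₗ coneMap 𝕜 u)
      (fun t ht => linkMap_boundary_cone_single ht.1), Submodule.map_comp, Submodule.map_comp]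
    refine Submodule.map_mono (Submodule.map_mono (map_spanSubset_le fun t ht => ?_))
    rw [coneMap_single ht.1]
    exact single_mem_spanSubset ht.2 1
  have h3 : Module.finrank 𝕜 ((Pi.spanSubset 𝕜 {t | u ∉ t ∧ insert u t ∈ K}).map
      (twist 𝕜 u ∘ₗ simplicialBoundary 𝕜 V ∘ₗ twist 𝕜 u)) =
      rankOn 𝕜 {t | u ∉ t ∧ insert u t ∈ K} := by
    rw [Submodule.map_comp, Submodule.map_comp, map_twist_spanSubset, rankOn]
    exact LinearEquiv.finrank_eq (Submodule.equivMapOfInjective _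
      (Function.LeftInverse.injective (twist_twist u)) _).symm
  have h4 := Submodule.finrank_mono h2
  rw [h3] at h4
  change Module.finrank 𝕜 _ + rankOn 𝕜 _ ≤ Module.finrank 𝕜 R
  omega

/-- Composed with the projection to simplices avoiding u, ∂ is an invertible diagonal map on the
simplices that contain u, so it has full rank there. -/
theorem ncard_link_le_rankOn (K : Set (Finset V)) (u : V) :
    {t | u ∉ t ∧ insert u t ∈ K}.ncard ≤ rankOn 𝕜 K := by
  set L := {t | u ∉ t ∧ insert u t ∈ K}
  have hinj : Function.Injective (lowerTwist 𝕜 u) :=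
    Function.LeftInverse.injective (lowerTwist_lowerTwist u)
  have h1 : Module.finrank 𝕜 ((Pi.spanSubset 𝕜 L).map (lowerTwist 𝕜 u)) = L.ncard := by
    rw [LinearEquiv.finrank_eq (Submodule.equivMapOfInjective _ hinj _).symm, Pi.dim_spanSubset]
  rw [← h1, ← map_spanSubset_congr
      (φ := deletionMap 𝕜 u ∘ₗ simplicialBoundary 𝕜 V ∘ₗ coneMap 𝕜 u)
      (fun t ht => deletionMap_boundary_cone_single ht.1), Submodule.map_comp, Submodule.map_comp]
  refine (Submodule.finrank_map_le _ _).trans (Submodule.finrank_mono (Submodule.map_mono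
    (map_spanSubset_le fun t ht => ?_)))
  rw [coneMap_single ht.1]
  exact single_mem_spanSubset ht.2 1

end SimplicialBoundary

/-! ### The total Betti number of a family of simplices -/

namespace SimplicialBoundary

open Finset

variable (𝕜 : Type v) [Field 𝕜] {V : Type u} [LinearOrder V]

/-- The members with `j` elements of a family of simplices. -/
def level (K : Set (Finset V)) (j : ℕ) : Set (Finset V) := {s | s ∈ K ∧ s.card = j}

theorem link_level (K : Set (Finset V)) (u : V) (j : ℕ) :
    {t | u ∉ t ∧ insert u t ∈ level K (j + 1)} = level {t | u ∉ t ∧ insert u t ∈ K} j := by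
  ext t
  simp only [level, Set.mem_ofPred_eq, and_assoc]
  refine and_congr_right fun h => and_congr_right fun _ => ?_
  rw [card_insert_of_notMem h]
  omega

variable [Fintype V]

/-- The number of simplices minus twice the rank of the boundary operator. For a simplicial complex
this is the total reduced Betti number. -/
noncomputable def totalBetti (K : Set (Finset V)) : ℤ :=
  K.ncard - 2 * ∑ j ∈ range (Fintype.card V + 1), (rankOn 𝕜 (level K j) : ℤ)

theorem ncard_eq_deletion_add_link (K : Set (Finset V)) (u : V) :
    K.ncard = {s | s ∈ K ∧ u ∉ s}.ncard + {t | u ∉ t ∧ insert u t ∈ K}.ncard := by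
  have h1 : {s | s ∈ K ∧ u ∈ s}.ncard = {t | u ∉ t ∧ insert u t ∈ K}.ncard := by
    have himg : (fun t => insert u t) '' {t | u ∉ t ∧ insert u t ∈ K} = {s | s ∈ K ∧ u ∈ s} := by
      ext s
      constructor
      · rintro ⟨t, ht, rfl⟩
        exact ⟨ht.2, mem_insert_self u t⟩
      · rintro ⟨hs, hu⟩
        exact ⟨s.erase u, ⟨by simp, by rwa [insert_erase hu]⟩, insert_erase hu⟩
    rw [← himg]
    refine Set.InjOn.ncard_image fun s hs t ht h => ?_
    rw [← erase_insert hs.1, ← erase_insert ht.1]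
    exact congrArg (fun z => z.erase u) h
  rw [← h1, ← Set.ncard_union_eq (Set.disjoint_left.2 fun s hs hs' => hs.2 hs'.2)
    (Set.toFinite _) (Set.toFinite _)]
  congr 1
  ext s
  by_cases h : u ∈ s <;> simp [h]

theorem ncard_eq_sum_level {W : Type*} [Fintype W] (K : Set (Finset W)) :
    K.ncard = ∑ j ∈ range (Fintype.card W + 1), (level K j).ncard := by
  classical
  rw [Set.ncard_eq_toFinset_card' K,
    card_eq_sum_card_fiberwise (f := Finset.card) (t := range (Fintype.card W + 1))
      (fun s _ => by simpa [Nat.lt_succ_iff] using card_le_univ s)]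
  refine sum_congr rfl fun j _ => ?_
  rw [Set.ncard_eq_toFinset_card']
  congr 1
  ext s
  simp only [mem_filter, Set.mem_toFinset]
  rfl

theorem rankOn_level_zero (K : Set (Finset V)) : rankOn 𝕜 (level K 0) = 0 := by
  have : (Pi.spanSubset 𝕜 (level K 0)).map (simplicialBoundary 𝕜 V) ≤ ⊥ := by
    rw [Pi.spanSubset, Submodule.map_span, Submodule.span_le]
    rintro _ ⟨_, ⟨t, ht, rfl⟩, rfl⟩
    have h0 : t = ∅ := card_eq_zero.1 ht.2
    simp [h0, apply_single]
  rw [rankOn, le_bot_iff.1 this, finrank_bot]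

theorem level_link_card (K : Set (Finset V)) (u : V) :
    level {t | u ∉ t ∧ insert u t ∈ K} (Fintype.card V) = ∅ := by
  ext t
  simp only [level, Set.mem_ofPred_eq, Set.mem_empty_iff_false, iff_false, not_and]
  intro h hc
  have : t = univ := (card_eq_iff_eq_univ t).1 hc
  exact h.1 (this ▸ mem_univ u)

/-- Cardinalities are additive over deletion and link, while ranks are superadditive and enter with
a negative sign. -/
theorem totalBetti_le_deletion_add_link (K : Set (Finset V)) (u : V) :
    totalBetti 𝕜 K ≤
      totalBetti 𝕜 {s | s ∈ K ∧ u ∉ s} + totalBetti 𝕜 {t | u ∉ t ∧ insert u t ∈ K} := by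
  set D := {s | s ∈ K ∧ u ∉ s}
  set L := {t | u ∉ t ∧ insert u t ∈ K}
  have hr : ∀ j, rankOn 𝕜 (level D (j + 1)) + rankOn 𝕜 (level L j) ≤
      rankOn 𝕜 (level K (j + 1)) := by
    intro j
    have := rankOn_deletion_add_rankOn_link_le (𝕜 := 𝕜) (level K (j + 1)) u
    rw [link_level] at this
    refine le_trans (Nat.add_le_add_right (rankOn_mono ?_) _) this
    exact fun s hs => ⟨⟨hs.1.1, hs.2⟩, hs.1.2⟩
  have hs : ∑ j ∈ range (Fintype.card V), (rankOn 𝕜 (level D (j + 1)) : ℤ) +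
      ∑ j ∈ range (Fintype.card V), (rankOn 𝕜 (level L j) : ℤ) ≤
      ∑ j ∈ range (Fintype.card V), (rankOn 𝕜 (level K (j + 1)) : ℤ) := by
    rw [← sum_add_distrib]
    exact sum_le_sum fun j _ => mod_cast hr j
  simp only [totalBetti]
  -- Level j + 1 of K and of the deletion is matched with level j of the link. The unmatched terms,
  -- level 0 of K and of the deletion and the top level of the link, are all zero.
  rw [sum_range_succ' (fun j => (rankOn 𝕜 (level K j) : ℤ)),
    sum_range_succ' (fun j => (rankOn 𝕜 (level D j) : ℤ)),
    sum_range_succ (fun j => (rankOn 𝕜 (level L j) : ℤ)), level_link_card, rankOn_empty,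
    rankOn_level_zero, rankOn_level_zero, ncard_eq_deletion_add_link K u]
  push_cast
  linarith

/-- In a cone the deletion injects into the link L, so there are at most 2|L| simplices, while the
total rank is at least |L|. -/
theorem totalBetti_cone_nonpos (K : Set (Finset V)) (u : V)
    (h : ∀ s ∈ K, u ∉ s → insert u s ∈ K) : totalBetti 𝕜 K ≤ 0 := by
  set D := {s | s ∈ K ∧ u ∉ s}
  set L := {t | u ∉ t ∧ insert u t ∈ K}
  have hDL : D.ncard ≤ L.ncard :=
    Set.ncard_le_ncard (fun s hs => ⟨hs.2, h s hs.1 hs.2⟩) (Set.toFinite _)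
  have hs : (L.ncard : ℤ) ≤ ∑ j ∈ range (Fintype.card V), (rankOn 𝕜 (level K (j + 1)) : ℤ) := by
    rw [ncard_eq_sum_level, sum_range_succ, level_link_card, Set.ncard_empty, add_zero]
    push_cast
    refine sum_le_sum fun j _ => ?_
    have := ncard_link_le_rankOn (𝕜 := 𝕜) (level K (j + 1)) u
    rw [link_level] at this
    exact_mod_cast this
  simp only [totalBetti]
  rw [sum_range_succ' (fun j => (rankOn 𝕜 (level K j) : ℤ)), ncard_eq_deletion_add_link K u]
  push_cast
  have : (D.ncard : ℤ) ≤ L.ncard := by exact_mod_cast hDL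
  have : (0 : ℤ) ≤ (rankOn 𝕜 (level K 0) : ℤ) := by positivity
  linarith

theorem totalBetti_le_ncard (K : Set (Finset V)) : totalBetti 𝕜 K ≤ K.ncard := by
  have : (0 : ℤ) ≤ ∑ j ∈ range (Fintype.card V + 1), (rankOn 𝕜 (level K j) : ℤ) :=
    sum_nonneg fun j _ => by positivity
  simp only [totalBetti]
  linarith

/-- Homology is cycles modulo boundaries: rank–nullity on the chains gives the dimension of the
cycles, and the boundaries have the rank of ∂ one level higher. -/
theorem finrank_reducedHomology (X : AbstractSimplicialComplex V) (j : ℕ) :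
    Module.finrank 𝕜 (X.ReducedHomology 𝕜 j) +
      rankOn 𝕜 (level {s | s = ∅ ∨ s ∈ X.faces} (j + 1)) +
      rankOn 𝕜 (level {s | s = ∅ ∨ s ∈ X.faces} j) =
      (level {s | s = ∅ ∨ s ∈ X.faces} j).ncard := by
  set K : Set (Finset V) := {s | s = ∅ ∨ s ∈ X.faces}
  have hB : X.reducedBoundaries 𝕜 j ≤ X.reducedCycles 𝕜 j := by
    refine le_inf ?_ ?_
    · refine map_spanSubset_le fun t ht => ?_
      rw [apply_single]
      refine Submodule.sum_mem _ fun w hw => single_mem_spanSubset ?_ _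
      obtain ⟨ht, hc⟩ := ht
      refine ⟨?_, by rw [card_erase_of_mem hw, hc]; rfl⟩
      rcases ht with rfl | ht
      · simp at hw
      · rcases (t.erase w).eq_empty_or_nonempty with h0 | h0
        · exact Or.inl h0
        · exact Or.inr (X.isRelLowerSet_faces ht |>.2 (erase_subset w t) h0)
    · rintro _ ⟨x, _, rfl⟩
      exact apply_apply x
  have h1 := Submodule.finrank_quotient_add_finrank
    ((X.reducedBoundaries 𝕜 j).submoduleOf (X.reducedCycles 𝕜 j))
  have h2 : Module.finrank 𝕜 ((X.reducedBoundaries 𝕜 j).submoduleOf (X.reducedCycles 𝕜 j)) =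
      rankOn 𝕜 (level K (j + 1)) :=
    LinearEquiv.finrank_eq (Submodule.submoduleOfEquivOfLe hB)
  have h3 := ((simplicialBoundary 𝕜 V).domRestrict
    (X.reducedChains 𝕜 j)).finrank_range_add_finrank_ker
  have h4 : Module.finrank 𝕜 (LinearMap.ker ((simplicialBoundary 𝕜 V).domRestrict
      (X.reducedChains 𝕜 j))) = Module.finrank 𝕜 (X.reducedCycles 𝕜 j) := by
    rw [LinearMap.ker_domRestrict]
    refine LinearEquiv.finrank_eq ?_
    exact (Submodule.comap_equiv_self_of_inj_of_le (f := (X.reducedChains 𝕜 j).subtype)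
      (p := X.reducedCycles 𝕜 j) (Submodule.injective_subtype _) (by
        rw [Submodule.range_subtype]; exact inf_le_left)) |>.symm.trans
        (LinearEquiv.ofEq _ _ (by
          rw [AbstractSimplicialComplex.reducedCycles, Submodule.comap_inf]; simp)) |>.symm
  have h5 : Module.finrank 𝕜 (X.reducedChains 𝕜 j) = (level K j).ncard := Pi.dim_spanSubset
  rw [LinearMap.range_domRestrict, h4, h5] at h3
  have h6 : Module.finrank 𝕜 ((X.reducedChains 𝕜 j).map (simplicialBoundary 𝕜 V)) =
    rankOn 𝕜 (level K j) := rfl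
  rw [h2] at h1
  rw [h6] at h3
  change Module.finrank 𝕜 (_ ⧸ _) + _ + _ = _
  omega

/-- Each rank is subtracted twice, once for the boundaries it produces and once for the cycles it
removes. -/
theorem totalReducedBetti_eq (X : AbstractSimplicialComplex V) :
    (X.totalReducedBetti 𝕜 : ℤ) = totalBetti 𝕜 {s | s = ∅ ∨ s ∈ X.faces} := by
  set K : Set (Finset V) := {s | s = ∅ ∨ s ∈ X.faces}
  have h : ∑ j ∈ range (Fintype.card V + 1), (Module.finrank 𝕜 (X.ReducedHomology 𝕜 j) : ℤ) +
      ∑ j ∈ range (Fintype.card V + 1), (rankOn 𝕜 (level K (j + 1)) : ℤ) +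
      ∑ j ∈ range (Fintype.card V + 1), (rankOn 𝕜 (level K j) : ℤ) = K.ncard := by
    rw [ncard_eq_sum_level K, ← sum_add_distrib, ← sum_add_distrib]
    push_cast
    exact sum_congr rfl fun j _ => mod_cast finrank_reducedHomology 𝕜 X j
  have htop : level K (Fintype.card V + 1) = ∅ := by
    ext t
    simp only [level, Set.mem_ofPred_eq, Set.mem_empty_iff_false, iff_false, not_and]
    intro _ hc
    have := card_le_univ t
    omega
  have hshift : ∑ j ∈ range (Fintype.card V + 1), (rankOn 𝕜 (level K (j + 1)) : ℤ) =
      ∑ j ∈ range (Fintype.card V + 1), (rankOn 𝕜 (level K j) : ℤ) := by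
    rw [sum_range_succ, htop, rankOn_empty, sum_range_succ', rankOn_level_zero]
  rw [AbstractSimplicialComplex.totalReducedBetti, totalBetti]
  push_cast
  linarith

end SimplicialBoundary

/-! ### Independence complexes of induced subgraphs -/

namespace SimpleGraph

open SimplicialBoundary Finset

variable (𝕜 : Type v) [Field 𝕜] {V : Type u} [Fintype V] [LinearOrder V] (G : SimpleGraph V)

/-- The total reduced Betti number of the independence complex of the subgraph induced on `S`. -/
noncomputable def bettiOn (S : Finset V) : ℝ :=
  (totalBetti 𝕜 {s : Finset V | s ⊆ S ∧ G.IsIndepSet (s : Set V)} : ℝ)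

theorem bettiOn_empty_le : G.bettiOn 𝕜 ∅ ≤ 1 := by
  have h : {s : Finset V | s ⊆ ∅ ∧ G.IsIndepSet (s : Set V)} = {∅} := by
    ext s
    simp only [subset_empty, Set.mem_ofPred_eq, Set.mem_singleton_iff, and_iff_left_iff_imp]
    rintro rfl
    simp
  have := totalBetti_le_ncard 𝕜 {s : Finset V | s ⊆ ∅ ∧ G.IsIndepSet (s : Set V)}
  rw [bettiOn]
  rw [h] at this ⊢
  rw [Set.ncard_singleton] at this
  exact_mod_cast this

/-- An isolated vertex extends every independent set, so the complex is a cone with apex v. -/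
theorem bettiOn_nonpos {S : Finset V} {v : V} (hv : v ∈ S) (h : ∀ x ∈ S, ¬ G.Adj v x) :
    G.bettiOn 𝕜 S ≤ 0 := by
  rw [bettiOn]
  refine mod_cast totalBetti_cone_nonpos 𝕜 _ v fun s hs _ => ⟨insert_subset hv hs.1, ?_⟩
  rw [coe_insert]
  refine hs.2.insert fun x hx _ => ⟨h x (hs.1 hx), fun hadj => h x (hs.1 hx) hadj.symm⟩

/-- The deletion and the link of u are the independence complexes on S − u and on S − N[u]. -/
theorem bettiOn_le [DecidableRel G.Adj] {S : Finset V} {u : V} (hu : u ∈ S) :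
    G.bettiOn 𝕜 S ≤
      G.bettiOn 𝕜 (S.erase u) + G.bettiOn 𝕜 (S.filter fun x => x ≠ u ∧ ¬ G.Adj u x) := by
  have h := totalBetti_le_deletion_add_link 𝕜
    {s : Finset V | s ⊆ S ∧ G.IsIndepSet (s : Set V)} u
  have h1 : {s | s ∈ {s : Finset V | s ⊆ S ∧ G.IsIndepSet (s : Set V)} ∧ u ∉ s} =
      {s : Finset V | s ⊆ S.erase u ∧ G.IsIndepSet (s : Set V)} := by
    ext s
    simp only [Set.mem_ofPred_eq, subset_erase]
    tauto
  have h2 : {t | u ∉ t ∧ insert u t ∈ {s : Finset V | s ⊆ S ∧ G.IsIndepSet (s : Set V)}} =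
      {s : Finset V | s ⊆ S.filter (fun x => x ≠ u ∧ ¬ G.Adj u x) ∧
        G.IsIndepSet (s : Set V)} := by
    ext t
    simp only [Set.mem_ofPred_eq, insert_subset_iff, coe_insert]
    constructor
    · rintro ⟨hut, ⟨_, htS⟩, hind⟩
      refine ⟨fun x hx => mem_filter.2 ⟨htS hx, fun e => hut (e ▸ hx), ?_⟩, hind.mono (Set.subset_insert _ _)⟩
      exact hind (Set.mem_insert _ _) (Set.mem_insert_of_mem _ hx) fun e => hut (e ▸ hx)
    · rintro ⟨hsub, hind⟩
      have ht : ∀ {x}, x ∈ t → x ∈ S ∧ x ≠ u ∧ ¬ G.Adj u x := fun hx => mem_filter.1 (hsub hx)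
      refine ⟨fun hut => (ht hut).2.1 rfl, ⟨hu, fun x hx => (ht hx).1⟩, ?_⟩
      exact hind.insert fun x hx _ => ⟨(ht hx).2.2, fun hadj => (ht hx).2.2 hadj.symm⟩
  rw [h1, h2] at h
  simp only [bettiOn]
  exact_mod_cast h

theorem indepBetti_eq_bettiOn : (G.indepBetti 𝕜 : ℝ) = G.bettiOn 𝕜 univ := by
  rw [indepBetti, bettiOn, ← Int.cast_natCast, totalReducedBetti_eq]
  congr 2
  ext s
  rcases s.eq_empty_or_nonempty with rfl | h
  · simp
  · simp [indepComplex, h, h.ne_empty]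

end SimpleGraph

/-! ### Branching inequalities and the setting of the induction -/

namespace SimpleGraph

namespace Branching

set_option linter.unusedSectionVars false

open Finset

variable {V : Type u} [DecidableEq V] (G : SimpleGraph V) [DecidableRel G.Adj]

/-- The degree of `v` in the subgraph induced on `S`. -/
def degOn (S : Finset V) (v : V) : ℕ := (S.filter (G.Adj v)).card

/-- The vertices of `S` that are not in `P`, not equal to `u`, and not adjacent to `u`. -/
def rest (S : Finset V) (P : List V) (u : V) : Finset V :=
  S.filter fun y => y ∉ P ∧ y ≠ u ∧ ¬ G.Adj u y

/-- The list `l` enumerates the neighbours of `v` in `S`. -/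
def Nbrs (S : Finset V) (v : V) (l : List V) : Prop :=
  l.Nodup ∧ ∀ y, y ∈ l ↔ y ∈ S ∧ G.Adj v y

/-- The component of `v` in the subgraph induced on `S` is a triangle. -/
def TriangleOn (S : Finset V) (v : V) : Prop :=
  ∃ a b, a ∈ S ∧ b ∈ S ∧ G.Adj v a ∧ G.Adj v b ∧ G.Adj a b ∧
    (∀ y ∈ S, G.Adj v y → y = a ∨ y = b) ∧ (∀ y ∈ S, G.Adj a y → y = v ∨ y = b) ∧
    ∀ y ∈ S, G.Adj b y → y = v ∨ y = a

/-- The sum of the values of `f` obtained by deleting the vertices of `l` one after the other. -/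
def branchSum (f : Finset V → ℝ) (S : Finset V) : List V → List V → ℝ
  | _, [] => 0
  | P, u :: l => f (rest G S P u) + branchSum f S (u :: P) l

variable {G} {S T : Finset V} {P l : List V} {u v w y : V}

@[grind =]
theorem mem_rest : y ∈ rest G S P u ↔ y ∈ S ∧ y ∉ P ∧ y ≠ u ∧ ¬ G.Adj u y := by
  simp [rest]

theorem rest_subset : rest G S P u ⊆ S := filter_subset _ _

theorem degOn_mono (h : T ⊆ S) (v : V) : degOn G T v ≤ degOn G S v :=
  card_le_card (filter_subset_filter _ h)

theorem degOn_add_length_le (h : T ⊆ S) (hl : l.Nodup)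
    (hr : ∀ r ∈ l, r ∈ S ∧ G.Adj w r ∧ r ∉ T) : degOn G T w + l.length ≤ degOn G S w := by
  rw [← List.toFinset_card_of_nodup hl, degOn, ← card_union_of_disjoint]
  · refine card_le_card fun y hy => ?_
    simp only [mem_union, mem_filter, List.mem_toFinset] at hy ⊢
    rcases hy with hy | hy
    · exact ⟨h hy.1, hy.2⟩
    · exact ⟨(hr y hy).1, (hr y hy).2.1⟩
  · rw [Finset.disjoint_left]
    intro y hy hy'
    exact (hr y (List.mem_toFinset.1 hy')).2.2 (mem_filter.1 hy).1

/-- The lost vertices u, the neighbours of u, and the entries of l are pairwise distinct. All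
exponents below are counted in this way. -/
theorem card_rest_add_le (hu : u ∈ S) (hl : l.Nodup)
    (hp : ∀ p ∈ l, p ∈ S ∧ p ∈ P ∧ p ≠ u ∧ ¬ G.Adj u p) :
    (rest G S P u).card + (degOn G S u + 1 + l.length) ≤ S.card := by
  have h1 : (rest G S P u ∪ (insert u (S.filter (G.Adj u)) ∪ l.toFinset)).card =
      (rest G S P u).card + (degOn G S u + 1 + l.length) := by
    rw [card_union_of_disjoint, card_union_of_disjoint, card_insert_of_notMem (by simp),
      List.toFinset_card_of_nodup hl, degOn]
    · rw [Finset.disjoint_left]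
      intro y hy hy'
      have := hp y (List.mem_toFinset.1 hy')
      rcases mem_insert.1 hy with rfl | hy
      · exact this.2.2.1 rfl
      · exact this.2.2.2 (mem_filter.1 hy).2
    · rw [Finset.disjoint_left]
      intro y hy hy'
      rw [mem_rest] at hy
      rcases mem_union.1 hy' with hy' | hy'
      · rcases mem_insert.1 hy' with rfl | hy'
        · exact hy.2.2.1 rfl
        · exact hy.2.2.2 (mem_filter.1 hy').2
      · exact hy.2.1 (hp y (List.mem_toFinset.1 hy')).2.1
  rw [← h1]
  refine card_le_card fun y hy => ?_
  simp only [mem_union, mem_insert, mem_filter, List.mem_toFinset, mem_rest] at hy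
  rcases hy with hy | (rfl | hy) | hy
  · exact hy.1
  · exact hu
  · exact hy.1
  · exact (hp y hy).1

theorem Nbrs.degOn (h : Nbrs G S v l) : degOn G S v = l.length := by
  rw [Branching.degOn, ← List.toFinset_card_of_nodup h.1]
  congr 1
  ext y
  simp [h.2 y]

theorem Nbrs.perm {l' : List V} (h : Nbrs G S v l) (hl : l.Perm l') : Nbrs G S v l' :=
  ⟨hl.nodup h.1, fun y => by rw [← hl.mem_iff, h.2 y]⟩

theorem Nbrs.congr {l' : List V} (h : Nbrs G S v l) (hd : l'.Nodup) (hm : ∀ y, y ∈ l' ↔ y ∈ l) :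
    Nbrs G S v l' :=
  ⟨hd, fun y => by rw [hm, h.2 y]⟩

/-- Distinct neighbours that are as many as the degree enumerate all neighbours. -/
theorem nbrs_of_degOn_le (hl : l.Nodup) (h : ∀ y ∈ l, y ∈ S ∧ G.Adj v y)
    (hd : degOn G S v ≤ l.length) : Nbrs G S v l := by
  refine ⟨hl, fun y => ⟨h y, fun hy => ?_⟩⟩
  have hsub : l.toFinset ⊆ S.filter (G.Adj v) := fun z hz => by
    simpa using h z (List.mem_toFinset.1 hz)
  have := eq_of_subset_of_card_le hsub (by rw [List.toFinset_card_of_nodup hl]; exact hd)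
  rw [← List.mem_toFinset, this]
  simpa using hy

theorem exists_nbrs (G : SimpleGraph V) [DecidableRel G.Adj] (S : Finset V) (v : V) :
    ∃ l, Nbrs G S v l ∧ l.length = degOn G S v :=
  ⟨(S.filter (G.Adj v)).toList, ⟨nodup_toList _, fun y => by simp⟩, by simp [degOn]⟩

/-- Complete a list of distinct neighbours to an enumeration of all neighbours. -/
theorem exists_nbrs_append (hl : l.Nodup) (h : ∀ y ∈ l, y ∈ S ∧ G.Adj v y) :
    ∃ l', Nbrs G S v (l ++ l') ∧ l.length + l'.length = degOn G S v := by
  have hN : Nbrs G S v (l ++ ((S.filter (G.Adj v)) \ l.toFinset).toList) := by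
    refine ⟨List.nodup_append'.2 ⟨hl, nodup_toList _, fun y hy hy' => ?_⟩, fun y => ?_⟩
    · simp only [mem_toList, mem_sdiff, List.mem_toFinset] at hy'
      exact hy'.2 hy
    · simp only [List.mem_append, mem_toList, mem_sdiff, mem_filter, List.mem_toFinset]
      have := h y
      tauto
  exact ⟨_, hN, by rw [hN.degOn, List.length_append]⟩

/-- A real function on vertex sets that satisfies the inequalities coming from the deletion and the
link of a vertex. -/
structure IsBranching (G : SimpleGraph V) [DecidableRel G.Adj] (f : Finset V → ℝ) : Prop where
  empty_le : f ∅ ≤ 1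
  isolated : ∀ {S : Finset V} {v : V}, v ∈ S → (∀ y ∈ S, ¬ G.Adj v y) → f S ≤ 0
  branch : ∀ {S : Finset V} {u : V}, u ∈ S →
    f S ≤ f (S.erase u) + f (S.filter fun y => y ≠ u ∧ ¬ G.Adj u y)

variable {f : Finset V → ℝ}

/-- Each deletion of a neighbour of v leaves one link term behind; once all neighbours are deleted,
v is isolated and the remainder is at most 0. -/
theorem IsBranching.le_branchSum_aux (hf : IsBranching G f) (hv : v ∈ S) (l P : List V)
    (hvP : v ∉ P) (hvl : v ∉ l) (hl : ∀ y ∈ l, y ∈ S) (hd : l.Nodup) (hlP : ∀ y ∈ l, y ∉ P)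
    (hN : ∀ y ∈ S, G.Adj v y → y ∈ P ∨ y ∈ l) :
    f (S.filter (· ∉ P)) ≤ branchSum G f S P l := by
  induction l generalizing P with
  | nil =>
    refine hf.isolated (v := v) (by simp [hv, hvP]) fun y hy hadj => ?_
    rw [mem_filter] at hy
    rcases hN y hy.1 hadj with h | h
    · exact hy.2 h
    · simp at h
  | cons u l ih =>
    have h1 := hf.branch (S := S.filter (· ∉ P)) (u := u)
      (by simp [hl u (by simp), hlP u (by simp)])
    have h2 := ih (u :: P) (by grind) (by grind) (by grind) (by grind) (by grind) (by grind)
    have h3 : (S.filter (· ∉ P)).erase u = S.filter (· ∉ u :: P) := by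
      ext y; simp only [mem_erase, mem_filter, List.mem_cons]; tauto
    have h4 : ((S.filter (· ∉ P)).filter fun y => y ≠ u ∧ ¬ G.Adj u y) = rest G S P u := by
      ext y; simp only [mem_rest, mem_filter]; tauto
    rw [h3, h4] at h1
    rw [branchSum]
    linarith

theorem IsBranching.le_branchSum (hf : IsBranching G f) (hv : v ∈ S) (h : Nbrs G S v l) :
    f S ≤ branchSum G f S [] l := by
  have := hf.le_branchSum_aux hv l [] (by simp)
    (fun hvl => G.loopless.irrefl v ((h.2 v).1 hvl).2) (fun y hy => ((h.2 y).1 hy).1) h.1 (by simp)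
    (fun y hy hadj => Or.inr ((h.2 y).2 ⟨hy, hadj⟩))
  simpa using this

/-- The hypotheses of the induction step at the vertex set `S`: the bounds hold for smaller sets,
relative to the value `M` of the bound at `S`. Here `x = 2 ^ (-1 / 3)`. -/
structure Step (G : SimpleGraph V) [DecidableRel G.Adj] (f : Finset V → ℝ) (x M : ℝ)
    (S : Finset V) : Prop extends IsBranching G f where
  pos : 0 < x
  cube : x ^ 3 = 1 / 2
  nonneg : 0 ≤ M
  cliqueFree : ∀ a b c d, G.Adj a b → G.Adj a c → G.Adj a d → G.Adj b c → G.Adj b d →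
    ¬ G.Adj c d
  bound : ∀ T k, T.card + k ≤ S.card → 1 ≤ k → f T ≤ x ^ k * M
  boundLow : ∀ T k, T.card + k ≤ S.card → 1 ≤ k →
    (∃ w ∈ T, degOn G T w ≤ 3 ∧ ¬ TriangleOn G T w) →
    f T ≤ (x ^ 4 + x ^ 5 + x ^ 6) * (x ^ k * M)

namespace Step

variable {x M : ℝ}

/-- By x³ = 1/2 each power of x times M is a rational multiple of M, xM or x²M. With the decimal
enclosures of x and x², the final comparison of each case becomes linear arithmetic. -/
theorem nums (h : Step G f x M S) :
    x ^ 3 * M = M / 2 ∧ x ^ 4 * M = x * M / 2 ∧ x ^ 5 * M = x ^ 2 * M / 2 ∧ x ^ 6 * M = M / 4 ∧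
      x ^ 7 * M = x * M / 4 ∧ x ^ 8 * M = x ^ 2 * M / 4 ∧ x ^ 9 * M = M / 8 ∧
      x ^ 10 * M = x * M / 8 ∧ x ^ 11 * M = x ^ 2 * M / 8 ∧ x ^ 12 * M = M / 16 ∧
      x ^ 13 * M = x * M / 16 ∧
      7937 / 10000 * M ≤ x * M ∧ x * M ≤ 7938 / 10000 * M ∧
      6299 / 10000 * M ≤ x ^ 2 * M ∧ x ^ 2 * M ≤ 6300 / 10000 * M := by
  have h3 := h.cube
  have hp := h.pos
  have hl : 79370 / 100000 ≤ x := by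
    by_contra hc
    push Not at hc
    have : x ^ 3 < (79370 / 100000 : ℝ) ^ 3 := pow_lt_pow_left₀ hc hp.le (by norm_num)
    norm_num at this
    linarith
  have hu : x ≤ 79371 / 100000 := by
    by_contra hc
    push Not at hc
    have : (79371 / 100000 : ℝ) ^ 3 < x ^ 3 := pow_lt_pow_left₀ hc (by norm_num) (by norm_num)
    norm_num at this
    linarith
  have hl2 : 6299 / 10000 ≤ x ^ 2 := by nlinarith
  have hu2 : x ^ 2 ≤ 6300 / 10000 := by nlinarith
  have e6 : x ^ 6 = 1 / 4 := by rw [show x ^ 6 = (x ^ 3) ^ 2 by ring, h3]; norm_num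
  have e9 : x ^ 9 = 1 / 8 := by rw [show x ^ 9 = (x ^ 3) ^ 3 by ring, h3]; norm_num
  have e12 : x ^ 12 = 1 / 16 := by rw [show x ^ 12 = (x ^ 3) ^ 4 by ring, h3]; norm_num
  have hM := h.nonneg
  refine ⟨by rw [h3]; ring, ?_, ?_, by rw [e6]; ring, ?_, ?_, by rw [e9]; ring, ?_, ?_,
    by rw [e12]; ring, ?_, ?_, ?_, ?_, ?_⟩
  · linear_combination x * M * h3
  · linear_combination x ^ 2 * M * h3
  · linear_combination x * M * e6
  · linear_combination x ^ 2 * M * e6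
  · linear_combination x * M * e9
  · linear_combination x ^ 2 * M * e9
  · linear_combination x * M * e12
  · exact mul_le_mul_of_nonneg_right (by linarith) hM
  · exact mul_le_mul_of_nonneg_right (by linarith) hM
  · exact mul_le_mul_of_nonneg_right (by linarith) hM
  · exact mul_le_mul_of_nonneg_right (by linarith) hM

theorem le_bound (h : Step G f x M S) {k : ℕ} (hu : u ∈ S) (l : List V)
    (hl : l.Nodup ∧ ∀ p ∈ l, p ∈ S ∧ p ∈ P ∧ p ≠ u ∧ ¬ G.Adj u p) (hk : 1 ≤ k)
    (hd : k ≤ degOn G S u + 1 + l.length) : f (rest G S P u) ≤ x ^ k * M :=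
  h.bound _ _ (by have := card_rest_add_le hu hl.1 hl.2; omega) hk

/-- Branching over the only neighbour u of w leaves a single term, which loses at least u and w;
this gains the extra exponent 2. If w is isolated, the value is at most 0. -/
theorem bound_leaf (h : Step G f x M S) {k : ℕ} (hT : T.card + k ≤ S.card) (hw : w ∈ T)
    (hd : degOn G T w ≤ 1) : f T ≤ x ^ (k + 2) * M := by
  obtain ⟨l, hN, hlen⟩ := exists_nbrs G T w
  have hb := h.le_branchSum hw hN
  match l, hN, hlen, hb with
  | [], _, _, hb =>
    rw [branchSum] at hb
    exact hb.trans (mul_nonneg (pow_nonneg h.pos.le _) h.nonneg)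
  | [u], hN, _, hb =>
    simp only [branchSum, add_zero] at hb
    have hu := (hN.2 u).1 (by simp)
    refine hb.trans (h.bound _ _ ?_ (by omega))
    have := card_rest_add_le (G := G) (P := []) hu.1 (l := []) (by simp) (by simp)
    have h1 : 1 ≤ degOn G T u := card_pos.2 ⟨w, by simp [hw, hu.2.symm]⟩
    simp only [List.length_nil] at this
    omega
  | _ :: _ :: _, _, hlen, _ =>
    simp only [List.length_cons] at hlen
    omega

theorem length_le_degOn (hl : l.Nodup) (h : ∀ y ∈ l, y ∈ S ∧ G.Adj v y) :
    l.length ≤ degOn G S v := by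
  rw [← List.toFinset_card_of_nodup hl]
  exact card_le_card fun y hy => by simpa using h y (List.mem_toFinset.1 hy)

/-- If neither neighbour a, b of w is a leaf, the terms lose at least 3 vertices each, and one of
them loses a fourth: if a and b are not adjacent, the earlier deleted a also counts for b; if they
are adjacent, one of them has a third neighbour, since otherwise the component is a triangle. -/
theorem bound_deg_two (h : Step G f x M S) {k : ℕ} (hT : T.card + k ≤ S.card) (hw : w ∈ T)
    (hd : degOn G T w ≤ 2) (hn : ¬ TriangleOn G T w) :
    f T ≤ x ^ (k + 3) * M + x ^ (k + 4) * M := by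
  have hp := h.pos
  have hM := h.nonneg
  have leaf : ∀ w ∈ T, degOn G T w ≤ 1 → f T ≤ x ^ (k + 3) * M + x ^ (k + 4) * M := by
    intro w hw hd
    refine (h.bound_leaf hT hw hd).trans ?_
    rw [← add_mul]
    refine mul_le_mul_of_nonneg_right ?_ hM
    -- The leaf bound is stronger: x² ≤ x³ + x⁴ amounts to 1 ≤ x + x², which holds since x ≥ 3/4.
    have e : x ^ (k + 3) + x ^ (k + 4) - x ^ (k + 2) = x ^ k * (x ^ 3 + x ^ 4 - x ^ 2) := by ring
    have : 0 ≤ x ^ 3 + x ^ 4 - x ^ 2 := by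
      have : x ^ 3 + x ^ 4 - x ^ 2 = x ^ 2 * (x + x ^ 2 - 1) := by ring
      rw [this]
      have h34 : 3 / 4 ≤ x := by
        by_contra hc
        push Not at hc
        have : x ^ 3 < (3 / 4 : ℝ) ^ 3 := pow_lt_pow_left₀ hc hp.le (by norm_num)
        rw [h.cube] at this
        norm_num at this
      have : 0 ≤ x + x ^ 2 - 1 := by nlinarith
      positivity
    have := mul_nonneg (pow_nonneg hp.le k) this
    linarith
  obtain ⟨l, hN, hlen⟩ := exists_nbrs G T w
  match l, hN, hlen with
  | [], _, hlen => exact leaf w hw (by simp at hlen; omega)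
  | [_], _, hlen => exact leaf w hw (by simp at hlen; omega)
  | _ :: _ :: _ :: _, _, hlen => simp only [List.length_cons] at hlen; omega
  | [a, b], hN, _ =>
    have ha := (hN.2 a).1 (by simp)
    have hb := (hN.2 b).1 (by simp)
    have hab : a ≠ b := by have := hN.1; simp at this; exact this
    by_cases hla : degOn G T a ≤ 1
    · exact leaf a ha.1 hla
    by_cases hlb : degOn G T b ≤ 1
    · exact leaf b hb.1 hlb
    have small : ∀ {u : V} {P : List V} {j : ℕ} (l : List V), u ∈ T →
        (l.Nodup ∧ ∀ p ∈ l, p ∈ T ∧ p ∈ P ∧ p ≠ u ∧ ¬ G.Adj u p) → 1 ≤ j →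
        j ≤ degOn G T u + 1 + l.length → f (rest G T P u) ≤ x ^ (k + j) * M := by
      intro u P j l hu hl h1 hj
      have := card_rest_add_le hu hl.1 hl.2
      exact h.bound _ _ (by omega) (by omega)
    by_cases hadj : G.Adj a b
    · by_cases h3 : 3 ≤ degOn G T a ∨ 3 ≤ degOn G T b
      · have main : ∀ a b, Nbrs G T w [a, b] → 2 ≤ degOn G T a → 3 ≤ degOn G T b →
            f T ≤ x ^ (k + 3) * M + x ^ (k + 4) * M := by
          intro a b hN h2 h3
          have hs := h.le_branchSum hw hN
          simp only [branchSum, add_zero] at hs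
          have t1 := small (u := a) (P := []) (j := 3) [] ((hN.2 a).1 (by simp)).1 (by simp)
            (by norm_num) (by simp; omega)
          have t2 := small (u := b) (P := [a]) (j := 4) [] ((hN.2 b).1 (by simp)).1 (by simp)
            (by norm_num) (by simp; omega)
          linarith
        rcases h3 with h3 | h3
        · exact main b a (hN.perm (List.Perm.swap _ _ _)) (by omega) h3
        · exact main a b hN (by omega) h3
      · exfalso
        apply hn
        have eq : ∀ a b : V, b ∈ T → G.Adj w a → G.Adj a b → w ≠ b → degOn G T a ≤ 2 →
            ∀ y ∈ T, G.Adj a y → y = w ∨ y = b := by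
          intro a b hb hwa hab hwb hd y hy hay
          by_contra hc
          push Not at hc
          have := length_le_degOn (G := G) (S := T) (v := a) (l := [w, b, y])
            (by simp [hwb, hc.1.symm, hc.2.symm]) (by simp [hw, hb, hy, hwa.symm, hab, hay])
          simp at this
          omega
        refine ⟨a, b, ha.1, hb.1, ha.2, hb.2, hadj, ?_,
          eq a b hb.1 ha.2 hadj hb.2.ne (by omega), eq b a ha.1 hb.2 hadj.symm ha.2.ne (by omega)⟩
        intro y hy hwy
        simpa using (hN.2 y).2 ⟨hy, hwy⟩
    · have hs := h.le_branchSum hw hN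
      simp only [branchSum, add_zero] at hs
      have t1 := small (u := a) (P := []) (j := 3) [] ha.1 (by simp)
        (by norm_num) (by simp; omega)
      have t2 := small (u := b) (P := [a]) (j := 4) [a] hb.1
        (by simp [ha.1, hab, show ¬ G.Adj b a from fun h => hadj h.symm])
        (by norm_num) (by simp; omega)
      linarith

/-- The constant 3 consists of 1 for u itself and 2 for the gain at the leaf w. -/
theorem le_bound_leaf (h : Step G f x M S) {k : ℕ} (hu : u ∈ S) (l : List V)
    (hl : l.Nodup ∧ ∀ p ∈ l, p ∈ S ∧ p ∈ P ∧ p ≠ u ∧ ¬ G.Adj u p) (hk : 2 ≤ k)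
    (hd : k ≤ degOn G S u + 3 + l.length) (hw : w ∈ rest G S P u)
    (hdw : degOn G (rest G S P u) w ≤ 1) : f (rest G S P u) ≤ x ^ k * M := by
  have := card_rest_add_le hu hl.1 hl.2
  have h2 := h.bound_leaf (k := k - 2) (by omega) hw hdw
  rwa [Nat.sub_add_cancel hk] at h2

theorem le_bound_deg_two (h : Step G f x M S) {k : ℕ} (hu : u ∈ S) (l : List V)
    (hl : l.Nodup ∧ ∀ p ∈ l, p ∈ S ∧ p ∈ P ∧ p ≠ u ∧ ¬ G.Adj u p)
    (hd : k ≤ degOn G S u + 1 + l.length) (hw : w ∈ rest G S P u)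
    (hdw : degOn G (rest G S P u) w ≤ 2) (hn : ¬ TriangleOn G (rest G S P u) w) :
    f (rest G S P u) ≤ x ^ (k + 3) * M + x ^ (k + 4) * M :=
  h.bound_deg_two (by have := card_rest_add_le hu hl.1 hl.2; omega) hw hdw hn

theorem le_bound_low (h : Step G f x M S) {k : ℕ} (hu : u ∈ S) (l : List V)
    (hl : l.Nodup ∧ ∀ p ∈ l, p ∈ S ∧ p ∈ P ∧ p ≠ u ∧ ¬ G.Adj u p) (hk : 1 ≤ k)
    (hd : k ≤ degOn G S u + 1 + l.length) (hw : w ∈ rest G S P u)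
    (hdw : degOn G (rest G S P u) w ≤ 3) (hn : ¬ TriangleOn G (rest G S P u) w) :
    f (rest G S P u) ≤ x ^ (k + 4) * M + x ^ (k + 5) * M + x ^ (k + 6) * M :=
  (h.boundLow _ k (by have := card_rest_add_le hu hl.1 hl.2; omega) hk ⟨w, hw, hdw, hn⟩).trans
    (le_of_eq (by ring))

theorem degOn_rest_add_length_le (l : List V) (hl : l.Nodup)
    (hr : ∀ r ∈ l, r ∈ S ∧ G.Adj w r ∧ r ∉ rest G S P u) :
    degOn G (rest G S P u) w + l.length ≤ degOn G S w :=
  degOn_add_length_le rest_subset hl hr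

end Step

end Branching

end SimpleGraph

/-! ### Vertices of degree at most three -/

namespace SimpleGraph

namespace Branching

set_option linter.unusedSectionVars false

open Finset

variable {V : Type u} [DecidableEq V] {G : SimpleGraph V} [DecidableRel G.Adj]
  {S T : Finset V} {u v w y a b c d : V} {f : Finset V → ℝ} {x M : ℝ}

theorem TriangleOn.of_closed (hTS : T ⊆ S) (hv : v ∈ T)
    (hcl : ∀ y ∈ T, ∀ z ∈ S, G.Adj y z → z ∈ T) (h : TriangleOn G T v) : TriangleOn G S v := by
  obtain ⟨a, b, ha, hb, hva, hvb, hab, h1, h2, h3⟩ := h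
  exact ⟨a, b, hTS ha, hTS hb, hva, hvb, hab, fun y hy hadj => h1 y (hcl v hv y hy hadj) hadj,
    fun y hy hadj => h2 y (hcl a ha y hy hadj) hadj,
    fun y hy hadj => h3 y (hcl b hb y hy hadj) hadj⟩

namespace Step

/-- The link is the path a, c, b. If b has degree 3, removing N[a] takes v and c away from it, so b
is at most a leaf and the exponents are 6, 5, 4; the same holds with a and b exchanged. If both have
degree at least 4, the exponents are 5, 6, 4. -/
theorem le_of_diamond (h : Step G f x M S) (hmin : ∀ y ∈ S, 3 ≤ degOn G S y) (hv : v ∈ S)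
    (hN : Nbrs G S v [a, b, c]) (hac : G.Adj a c) (hbc : G.Adj b c) (hab : ¬ G.Adj a b) :
    f S ≤ (x ^ 4 + x ^ 5 + x ^ 6) * M := by
  have sym := G.adj_comm
  have irr : ∀ u v, G.Adj u v → u ≠ v := fun _ _ h => h.ne
  have hd := hN.1
  have ha := (hN.2 a).1 (by simp)
  have hb := (hN.2 b).1 (by simp)
  have hc := (hN.2 c).1 (by simp)
  have main : ∀ a b, a ∈ S ∧ G.Adj v a → b ∈ S ∧ G.Adj v b → G.Adj a c → G.Adj b c →
      ¬ G.Adj a b → Nbrs G S v [a, b, c] → degOn G S b ≤ 3 →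
      f S ≤ (x ^ 4 + x ^ 5 + x ^ 6) * M := by
    intro a b ha hb hac hbc hab hN h3
    have hd := hN.1
    have hs := h.le_branchSum hv hN
    simp only [branchSum, add_zero] at hs
    have hdeg := degOn_rest_add_length_le (G := G) (S := S) (w := b) (P := []) (u := a) [v, c]
      (by grind) (by grind)
    have t1 := h.le_bound_leaf (k := 6) (w := b) (P := []) ha.1 [] (by simp) (by grind) (by grind)
      (by grind) (by grind)
    have t2 := h.le_bound (k := 5) (P := [a]) hb.1 [a] (by grind) (by grind) (by grind)
    have t3 := h.le_bound (k := 4) (P := [b, a]) hc.1 [] (by simp) (by grind) (by grind)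
    linarith
  by_cases h1 : degOn G S b ≤ 3
  · exact main a b ha hb hac hbc hab hN h1
  by_cases h2 : degOn G S a ≤ 3
  · exact main b a hb ha hbc hac (by grind) (hN.perm (List.Perm.swap _ _ _)) h2
  have hs := h.le_branchSum hv hN
  simp only [branchSum, add_zero] at hs
  have t1 := h.le_bound (k := 5) (P := []) ha.1 [] (by simp) (by grind) (by grind)
  have t2 := h.le_bound (k := 6) (P := [a]) hb.1 [a] (by grind) (by grind) (by grind)
  have t3 := h.le_bound (k := 4) (P := [b, a]) hc.1 [] (by simp) (by grind) (by grind)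
  linarith

/-- The exponents are 4, 6, 5: the earlier deleted c counts for both a and b. -/
theorem le_of_one_edge_of_degOn (h : Step G f x M S) (hmin : ∀ y ∈ S, 3 ≤ degOn G S y) (hv : v ∈ S)
    (hN : Nbrs G S v [c, a, b]) (hac : ¬ G.Adj a c) (hbc : ¬ G.Adj b c) (ha4 : 4 ≤ degOn G S a) :
    f S ≤ (x ^ 4 + x ^ 5 + x ^ 6) * M := by
  have hd := hN.1
  have ha := (hN.2 a).1 (by simp)
  have hb := (hN.2 b).1 (by simp)
  have hc := (hN.2 c).1 (by simp)
  have hs := h.le_branchSum hv hN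
  simp only [branchSum, add_zero] at hs
  have t1 := h.le_bound (k := 4) (P := []) hc.1 [] (by simp) (by grind) (by grind)
  have t2 := h.le_bound (k := 6) (P := [c]) ha.1 [c] (by grind) (by grind) (by grind)
  have t3 := h.le_bound (k := 5) (P := [a, c]) hb.1 [c] (by grind) (by grind) (by grind)
  linarith

/-- If c has degree at least 4, the exponents 5, 5, 5 suffice. Otherwise a and b each have a single
further neighbour, p and q. If p = q, the link of a is a path; if not, the term of c is improved by
one more branching, at p. -/
theorem le_of_one_edge (h : Step G f x M S) (hmin : ∀ y ∈ S, 3 ≤ degOn G S y) (hv : v ∈ S)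
    (hN : Nbrs G S v [c, a, b]) (hab : G.Adj a b) (hac : ¬ G.Adj a c) (hbc : ¬ G.Adj b c) :
    f S ≤ (x ^ 4 + x ^ 5 + x ^ 6) * M := by
  have sym := G.adj_comm
  have irr : ∀ u v, G.Adj u v → u ≠ v := fun _ _ h => h.ne
  have hd := hN.1
  have ha := (hN.2 a).1 (by simp)
  have hb := (hN.2 b).1 (by simp)
  have hc := (hN.2 c).1 (by simp)
  by_cases ha4 : 4 ≤ degOn G S a
  · exact h.le_of_one_edge_of_degOn hmin hv hN hac hbc ha4
  by_cases hb4 : 4 ≤ degOn G S b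
  · exact h.le_of_one_edge_of_degOn hmin hv (hN.perm (.cons _ (.swap _ _ _))) hbc hac hb4
  have hs := h.le_branchSum hv hN
  simp only [branchSum, add_zero] at hs
  have t2 := h.le_bound (k := 5) (P := [c]) ha.1 [c] (by grind) (by grind) (by grind)
  have t3 := h.le_bound (k := 5) (P := [a, c]) hb.1 [c] (by grind) (by grind) (by grind)
  have num := h.nums
  by_cases hc4 : 4 ≤ degOn G S c
  · have t1 := h.le_bound (k := 5) (P := []) hc.1 [] (by simp) (by grind) (by grind)
    linarith
  have ma := hmin a ha.1
  have mb := hmin b hb.1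
  obtain ⟨l, hNa, hla⟩ := exists_nbrs_append (G := G) (S := S) (v := a) (l := [v, b])
    (by grind) (by grind)
  obtain ⟨l', hNb, hlb⟩ := exists_nbrs_append (G := G) (S := S) (v := b) (l := [v, a])
    (by grind) (by grind)
  obtain ⟨p, rfl⟩ := List.length_eq_one_iff.1 (show l.length = 1 by grind)
  obtain ⟨q, rfl⟩ := List.length_eq_one_iff.1 (show l'.length = 1 by grind)
  simp only [List.cons_append, List.nil_append] at hNa hNb
  have hp := (hNa.2 p).1 (by simp)
  have hq := (hNb.2 q).1 (by simp)
  have hda := hNa.1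
  have hdb := hNb.1
  have hvp : ¬ G.Adj v p := fun hvp => by have := (hN.2 p).2 ⟨hp.1, hvp⟩; grind
  by_cases hpq : p = q
  · subst hpq
    exact h.le_of_diamond hmin ha.1 (hNa.perm (.cons _ (.swap _ _ _))) hb.2 hq.2.symm hvp
  have hbp : ¬ G.Adj b p := fun hbp => by have := (hNb.2 p).2 ⟨hp.1, hbp⟩; grind
  have hd3 : ∀ z ∈ S, G.Adj v z → z = a ∨ z = b ∨ z = c := fun z hz hvz => by
    have := (hN.2 z).2 ⟨hz, hvz⟩; grind
  set T := rest G S [] c with hT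
  have hcard : T.card + 4 ≤ S.card := by
    have := card_rest_add_le (G := G) (P := []) hc.1 (l := []) (by simp) (by simp)
    have := hmin c hc.1
    grind
  have haT : a ∈ T := by grind
  have hbT : b ∈ T := by grind
  have hvT : v ∉ T := by grind
  -- The terms of a and b cost 2x⁵, leaving about 0.332 M for the term of c, whereas x⁷ + x⁹ is
  -- about 0.323. A leaf in T already gives x⁶ = 1/4.
  suffices ht : f T ≤ x ^ 7 * M + x ^ 9 * M by linarith
  have leaf : ∀ z ∈ T, degOn G T z ≤ 1 → f T ≤ x ^ 7 * M + x ^ 9 * M := by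
    intro z hz hdz
    have : f T ≤ x ^ 6 * M := h.bound_leaf hcard hz hdz
    linarith
  by_cases hpT : p ∈ T
  swap
  · refine leaf a haT ?_
    have := degOn_add_length_le (G := G) (S := S) (T := T) (w := a) (l := [v, p]) rest_subset
      (by grind) (by grind)
    grind
  by_cases hp1 : degOn G T p ≤ 1
  · exact leaf p hpT hp1
  have hbr := h.branch hpT
  -- With v and p gone, b is the only possible neighbour of a: 4 + 1 vertices are lost and the leaf
  -- gains 2.
  have r1 : f (T.erase p) ≤ x ^ 7 * M := by
    refine h.bound_leaf (k := 5) (w := a) (by have := card_erase_add_one hpT; omega)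
      (by grind) ?_
    have := degOn_add_length_le (G := G) (S := S) (T := T.erase p) (w := a) (l := [v, p])
      ((erase_subset _ _).trans rest_subset) (by grind) (by grind)
    grind
  -- Removing N[p] takes a away from b, which is then at most a leaf: 4 + 3 vertices are lost and
  -- the leaf gains 2.
  have r2 : f (T.filter fun y => y ≠ p ∧ ¬ G.Adj p y) ≤ x ^ 9 * M := by
    have e : (T.filter fun y => y ≠ p ∧ ¬ G.Adj p y) = rest G T [] p := by simp [rest]
    rw [e]
    have := card_rest_add_le (G := G) (P := []) hpT (l := []) (by simp) (by simp)
    refine h.bound_leaf (k := 7) (w := b) (by simp at this; omega) (by grind) ?_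
    have := degOn_add_length_le (G := G) (S := S) (T := rest G T [] p) (w := b) (l := [v, a])
      (rest_subset.trans rest_subset) (by grind) (by grind)
    grind
  linarith

/-- The bound for graphs with a vertex of degree at most three outside triangle components. -/
theorem le_of_low (h : Step G f x M S)
    (hlow : ∃ v ∈ S, degOn G S v ≤ 3 ∧ ¬ TriangleOn G S v) :
    f S ≤ (x ^ 4 + x ^ 5 + x ^ 6) * M := by
  have sym := G.adj_comm
  have irr : ∀ u v, G.Adj u v → u ≠ v := fun _ _ h => h.ne
  have num := h.nums
  obtain ⟨v, hv, hv3, hvt⟩ := hlow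
  -- A triangle component splits off: both terms of the branching at t are S without the triangle, v
  -- keeps its properties there, and 2x³ = 1.
  by_cases htri : ∃ t ∈ S, TriangleOn G S t
  · obtain ⟨t, ht, a, b, ha, hb, hta, htb, hab, h1, h2, h3⟩ := htri
    have hne : v ≠ t ∧ v ≠ a ∧ v ≠ b := by
      refine ⟨?_, ?_, ?_⟩ <;> rintro rfl <;> apply hvt
      · exact ⟨a, b, ha, hb, hta, htb, hab, h1, h2, h3⟩
      · exact ⟨t, b, ht, hb, hta.symm, hab, htb, h2, h1, by grind⟩
      · exact ⟨t, a, ht, ha, htb.symm, hab.symm, hta, h3, by grind, by grind⟩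
    have hN : Nbrs G S t [a, b] := ⟨by grind, by grind⟩
    have hs := h.le_branchSum ht hN
    simp only [branchSum, add_zero] at hs
    have key : ∀ T ⊆ S, (∀ y ∈ S, y ∈ T ↔ y ≠ t ∧ y ≠ a ∧ y ≠ b) → T.card + 3 ≤ S.card →
        f T ≤ (x ^ 4 + x ^ 5 + x ^ 6) * (x ^ 3 * M) := by
      intro T hTS hT hcard
      refine h.boundLow _ _ hcard (by norm_num) ⟨v, (hT v hv).2 hne, (degOn_mono hTS v).trans hv3,
        fun hvT => hvt (hvT.of_closed hTS ((hT v hv).2 hne) ?_)⟩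
      intro y hy z hz hyz
      have := (hT y (hTS hy)).1 hy
      grind
    have hd2 : ∀ y, y = a ∨ y = b → 2 ≤ degOn G S y := by
      rintro y (rfl | rfl)
      · exact length_le_degOn (l := [t, b]) (by grind) (by grind)
      · exact length_le_degOn (l := [t, a]) (by grind) (by grind)
    have r1 := key (rest G S [] a) rest_subset (by grind) (by
      have := card_rest_add_le (G := G) (P := []) ha (l := []) (by simp) (by simp)
      grind)
    have r2 := key (rest G S [a] b) rest_subset (by grind) (by
      have := card_rest_add_le (G := G) (P := [a]) hb (l := []) (by simp) (by simp)
      grind)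
    have e : (x ^ 4 + x ^ 5 + x ^ 6) * (x ^ 3 * M) = (x ^ 4 + x ^ 5 + x ^ 6) * M / 2 := by
      rw [num.1]; ring
    linarith
  push Not at htri
  by_cases hmin : ∃ y ∈ S, degOn G S y ≤ 2
  · obtain ⟨y, hy, hy2⟩ := hmin
    have : f S ≤ x ^ 3 * M + x ^ 4 * M := by
      simpa using h.bound_deg_two (k := 0) le_rfl hy hy2 (htri y hy)
    linarith
  have hmin : ∀ y ∈ S, 3 ≤ degOn G S y := by
    intro y hy
    by_contra hc
    exact hmin ⟨y, hy, by omega⟩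
  obtain ⟨l, hN, hl⟩ := exists_nbrs G S v
  obtain ⟨a, b, c, rfl⟩ := List.length_eq_three.1 (hl.trans (le_antisymm hv3 (hmin v hv)))
  have hd := hN.1
  have ha := (hN.2 a).1 (by simp)
  have hb := (hN.2 b).1 (by simp)
  have hc := (hN.2 c).1 (by simp)
  have hNba : Nbrs G S v [b, a, c] := hN.perm (.swap _ _ _)
  have hNac : Nbrs G S v [a, c, b] := hN.perm (.cons _ (.swap _ _ _))
  have hNca : Nbrs G S v [c, a, b] := hNac.perm (.swap _ _ _)
  have hNbc : Nbrs G S v [b, c, a] := hNba.perm (.cons _ (.swap _ _ _))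
  -- Without K₄ the link of v is not a triangle. Two edges give the diamond, one edge the previous
  -- lemma, and no edge the exponents 4, 5, 6.
  by_cases hab : G.Adj a b <;> by_cases hac : G.Adj a c <;> by_cases hbc : G.Adj b c
  · exact absurd hbc (h.cliqueFree v a b c ha.2 hb.2 hc.2 hab hac)
  · exact h.le_of_diamond hmin hv hNbc hab.symm hac.symm hbc
  · exact h.le_of_diamond hmin hv hNac hab hbc.symm hac
  · exact h.le_of_one_edge hmin hv hNca hab hac hbc
  · exact h.le_of_diamond hmin hv hN hac hbc hab
  · exact h.le_of_one_edge hmin hv hNba hac hab (by grind)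
  · exact h.le_of_one_edge hmin hv hN hbc (by grind) (by grind)
  · have hs := h.le_branchSum hv hN
    simp only [branchSum, add_zero] at hs
    have t1 := h.le_bound (k := 4) (P := []) ha.1 [] (by simp) (by grind) (by grind)
    have t2 := h.le_bound (k := 5) (P := [a]) hb.1 [a] (by grind) (by grind) (by grind)
    have t3 := h.le_bound (k := 6) (P := [b, a]) hc.1 [a, b] (by grind) (by grind) (by grind)
    linarith

/-! ### A vertex of degree four, by the shape of its link -/

/-- At most c and d are adjacent, so the exponents are 5, 6, 7, 7. -/
theorem le_of_sparse_link (h : Step G f x M S) (hmin : ∀ y ∈ S, 4 ≤ degOn G S y) (hv : v ∈ S)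
    (hN : Nbrs G S v [a, b, c, d]) (hab : ¬ G.Adj a b) (hac : ¬ G.Adj a c) (had : ¬ G.Adj a d)
    (hbc : ¬ G.Adj b c) (hbd : ¬ G.Adj b d) : f S ≤ M := by
  have sym := G.adj_comm
  have hd := hN.1
  have ha := (hN.2 a).1 (by simp)
  have hb := (hN.2 b).1 (by simp)
  have hc := (hN.2 c).1 (by simp)
  have hd' := (hN.2 d).1 (by simp)
  have hs := h.le_branchSum hv hN
  simp only [branchSum, add_zero] at hs
  have num := h.nums
  have t1 := h.le_bound (k := 5) (P := []) ha.1 [] (by simp) (by grind) (by grind)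
  have t2 := h.le_bound (k := 6) (P := [a]) hb.1 [a] (by grind) (by grind) (by grind)
  have t3 := h.le_bound (k := 7) (P := [b, a]) hc.1 [a, b] (by grind) (by grind) (by grind)
  have t4 := h.le_bound (k := 7) (P := [c, b, a]) hd'.1 [a, b] (by grind) (by grind) (by grind)
  linarith

/-- Two nonadjacent vertices with three common neighbours. -/
theorem add_le_of_three_common (h : Step G f x M S) (hmin : ∀ y ∈ S, 4 ≤ degOn G S y)
    {p q r : V} {P Q : List V} (ha : a ∈ S) (hc : c ∈ S) (hac : ¬ G.Adj a c) (hne : a ≠ c)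
    (hd : degOn G S c ≤ degOn G S a) (hpqr : [p, q, r].Nodup)
    (hcom : ∀ z ∈ [p, q, r], z ∈ S ∧ G.Adj a z ∧ G.Adj c z) (hP : c ∉ P) (hQ : a ∈ Q) :
    f (rest G S P a) + f (rest G S Q c) ≤ x ^ 6 * M + x ^ 7 * M := by
  have sym := G.adj_comm
  have hc4 := hmin c hc
  -- If c has degree 4, it is at most a leaf after the removal of N[a], so the exponents are 7, 6;
  -- otherwise both degrees are at least 5 and they are 6, 7.
  by_cases h4 : degOn G S c = 4
  · have hdeg := degOn_rest_add_length_le (G := G) (S := S) (w := c) (P := P) (u := a) [p, q, r]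
      hpqr (by grind)
    have t1 := h.le_bound_leaf (k := 7) (w := c) (P := P) ha [] (by simp) (by grind) (by grind)
      (by grind) (by grind)
    have t2 := h.le_bound (k := 6) (P := Q) hc [a] (by grind) (by grind) (by grind)
    linarith
  · have t1 := h.le_bound (k := 6) (P := P) ha [] (by simp) (by grind) (by grind)
    have t2 := h.le_bound (k := 7) (P := Q) hc [a] (by grind) (by grind) (by grind)
    linarith

/-- Each pair of opposite vertices of the cycle has v and the other pair as common neighbours, so
the total is 2(x⁶ + x⁷). The symmetries of the cycle put the larger degree first in each pair. -/
theorem le_of_cycle_link (h : Step G f x M S) (hmin : ∀ y ∈ S, 4 ≤ degOn G S y) (hv : v ∈ S)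
    (hN : Nbrs G S v [a, b, c, d]) (hab : G.Adj a b) (hbc : G.Adj b c) (hcd : G.Adj c d)
    (had : G.Adj a d) (hac : ¬ G.Adj a c) (hbd : ¬ G.Adj b d) : f S ≤ M := by
  have sym := G.adj_comm
  have irr : ∀ u v, G.Adj u v → u ≠ v := fun _ _ h => h.ne
  have main : ∀ a b c d, Nbrs G S v [a, c, b, d] → G.Adj a b → G.Adj b c → G.Adj c d →
      G.Adj a d → ¬ G.Adj a c → ¬ G.Adj b d → degOn G S c ≤ degOn G S a →
      degOn G S d ≤ degOn G S b → f S ≤ M := by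
    intro a b c d hN hab hbc hcd had hac hbd hca hdb
    have hd := hN.1
    have ha := (hN.2 a).1 (by simp)
    have hb := (hN.2 b).1 (by simp)
    have hc := (hN.2 c).1 (by simp)
    have hd' := (hN.2 d).1 (by simp)
    have hs := h.le_branchSum hv hN
    simp only [branchSum, add_zero] at hs
    have num := h.nums
    have t1 := h.add_le_of_three_common hmin (p := v) (q := b) (r := d) (P := []) (Q := [a])
      ha.1 hc.1 hac (by grind) hca (by grind) (by grind) (by grind) (by grind)
    have t2 := h.add_le_of_three_common hmin (p := v) (q := a) (r := c) (P := [c, a])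
      (Q := [b, c, a]) hb.1 hd'.1 hbd (by grind) hdb (by grind) (by grind) (by grind) (by grind)
    linarith
  have hd := hN.1
  rcases le_total (degOn G S c) (degOn G S a) with h1 | h1 <;>
    rcases le_total (degOn G S d) (degOn G S b) with h2 | h2
  · exact main a b c d (hN.congr (by grind) (by grind)) hab hbc hcd had hac hbd h1 h2
  · exact main a d c b (hN.congr (by grind) (by grind)) had hcd.symm hbc.symm hab hac
      (by grind) h1 h2
  · exact main c b a d (hN.congr (by grind) (by grind)) hbc.symm hab.symm had hcd (by grind) hbd
      h1 h2
  · exact main c d a b (hN.congr (by grind) (by grind)) hcd had.symm hab hbc.symm (by grind)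
      (by grind) h1 h2

/-- A neighbour of degree at least 5 allows an order with exponents 6, 6, 6, 6, and 4x⁶ is exactly
1. Otherwise all four degrees are 4 and the order a, d, b, c gives 5, 8, 6, 6. -/
theorem le_of_path_link (h : Step G f x M S) (hmin : ∀ y ∈ S, 4 ≤ degOn G S y) (hv : v ∈ S)
    (hN : Nbrs G S v [a, b, c, d]) (hab : G.Adj a b) (hbc : G.Adj b c) (hcd : G.Adj c d)
    (had : ¬ G.Adj a d) (hac : ¬ G.Adj a c) (hbd : ¬ G.Adj b d) : f S ≤ M := by
  have sym := G.adj_comm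
  have irr : ∀ u v, G.Adj u v → u ≠ v := fun _ _ h => h.ne
  have big : ∀ a b c d, Nbrs G S v [a, b, c, d] → ¬ G.Adj a d → ¬ G.Adj a c → ¬ G.Adj b d →
      (5 ≤ degOn G S b ∨ 5 ≤ degOn G S d) → f S ≤ M := by
    intro a b c d hN had hac hbd h5
    have hd := hN.1
    have ha := (hN.2 a).1 (by simp)
    have hb := (hN.2 b).1 (by simp)
    have hc := (hN.2 c).1 (by simp)
    have hd' := (hN.2 d).1 (by simp)
    rcases h5 with h5 | h5
    · have hs := h.le_branchSum hv (hN.congr (l' := [b, d, a, c]) (by grind) (by grind))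
      simp only [branchSum, add_zero] at hs
      have t1 := h.le_bound (k := 6) (P := []) hb.1 [] (by simp) (by grind) (by grind)
      have t2 := h.le_bound (k := 6) (P := [b]) hd'.1 [b] (by grind) (by grind) (by grind)
      have t3 := h.le_bound (k := 6) (P := [d, b]) ha.1 [d] (by grind) (by grind) (by grind)
      have t4 := h.le_bound (k := 6) (P := [a, d, b]) hc.1 [a] (by grind) (by grind) (by grind)
      have num := h.nums
      linarith
    · have hs := h.le_branchSum hv (hN.congr (l' := [d, b, a, c]) (by grind) (by grind))
      simp only [branchSum, add_zero] at hs
      have t1 := h.le_bound (k := 6) (P := []) hd'.1 [] (by simp) (by grind) (by grind)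
      have t2 := h.le_bound (k := 6) (P := [d]) hb.1 [d] (by grind) (by grind) (by grind)
      have t3 := h.le_bound (k := 6) (P := [b, d]) ha.1 [d] (by grind) (by grind) (by grind)
      have t4 := h.le_bound (k := 6) (P := [a, b, d]) hc.1 [a] (by grind) (by grind) (by grind)
      have num := h.nums
      linarith
  have hd := hN.1
  simp only [List.nodup_cons, List.mem_cons, List.not_mem_nil, not_or, or_false] at hd
  by_cases h1 : 5 ≤ degOn G S b ∨ 5 ≤ degOn G S d
  · exact big a b c d hN had hac hbd h1
  by_cases h2 : 5 ≤ degOn G S c ∨ 5 ≤ degOn G S a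
  · exact big d c b a (hN.congr (by grind) (by grind)) (by grind) (by grind) (by grind) h2
  have ha := (hN.2 a).1 (by simp)
  have hb := (hN.2 b).1 (by simp)
  have hc := (hN.2 c).1 (by simp)
  have hd' := (hN.2 d).1 (by simp)
  have hs := h.le_branchSum hv (hN.congr (l' := [a, d, b, c]) (by grind) (by grind))
  simp only [branchSum, add_zero] at hs
  -- Once a and N[d] are removed, b has lost a, v and c. The resulting leaf raises the exponent of d
  -- from 6 to 8.
  have hdeg := degOn_rest_add_length_le (G := G) (S := S) (w := b) (P := [a]) (u := d) [v, a, c]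
    (by simp; grind) (by simp; grind)
  have t1 := h.le_bound (k := 5) (P := []) ha.1 [] (by simp) (by grind) (by grind)
  have t2 := h.le_bound_leaf (k := 8) (w := b) (P := [a]) hd'.1 [a] (by simp; grind) (by grind)
    (by grind) (by grind) (by grind)
  have t3 := h.le_bound (k := 6) (P := [d, a]) hb.1 [d] (by simp; grind) (by grind) (by grind)
  have t4 := h.le_bound (k := 6) (P := [b, d, a]) hc.1 [a] (by simp; grind) (by grind) (by grind)
  have num := h.nums
  linarith

theorem le_of_matching_link_of_degOn (h : Step G f x M S) (hmin : ∀ y ∈ S, 4 ≤ degOn G S y)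
    (hv : v ∈ S) (hN : Nbrs G S v [a, c, b, d]) (hac : ¬ G.Adj a c) (had : ¬ G.Adj a d)
    (hbc : ¬ G.Adj b c) (hbd : ¬ G.Adj b d) (h5 : 5 ≤ degOn G S a) : f S ≤ M := by
  have sym := G.adj_comm
  have hd := hN.1
  have ha := (hN.2 a).1 (by simp)
  have hb := (hN.2 b).1 (by simp)
  have hc := (hN.2 c).1 (by simp)
  have hd' := (hN.2 d).1 (by simp)
  have hs := h.le_branchSum hv hN
  simp only [branchSum, add_zero] at hs
  have t1 := h.le_bound (k := 6) (P := []) ha.1 [] (by simp) (by grind) (by grind)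
  have t2 := h.le_bound (k := 6) (P := [a]) hc.1 [a] (by grind) (by grind) (by grind)
  have t3 := h.le_bound (k := 6) (P := [c, a]) hb.1 [c] (by grind) (by grind) (by grind)
  have t4 := h.le_bound (k := 7) (P := [b, c, a]) hd'.1 [a, b] (by grind) (by grind) (by grind)
  have num := h.nums
  linarith

/-- The exponents 5, 6, 6, 7 give about 1.013, slightly too much. In the term of c the vertex b
keeps at most two neighbours, and in the term of b so does d. If either is not in a triangle
component there, x⁶ improves to x⁹ + x¹⁰, which is enough. -/
theorem le_or_triangleOn_of_matching_link (h : Step G f x M S) (hmin : ∀ y ∈ S, 4 ≤ degOn G S y)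
    (hv : v ∈ S) (hN : Nbrs G S v [a, c, b, d]) (hab : G.Adj a b) (hcd : G.Adj c d)
    (hac : ¬ G.Adj a c) (had : ¬ G.Adj a d)
    (hbc : ¬ G.Adj b c) (hbd : ¬ G.Adj b d) (hb4 : degOn G S b ≤ 4) (hd4 : degOn G S d ≤ 4) :
    f S ≤ M ∨ (TriangleOn G (rest G S [a] c) b ∧ TriangleOn G (rest G S [c, a] b) d) := by
  have sym := G.adj_comm
  have irr : ∀ u v, G.Adj u v → u ≠ v := fun _ _ h => h.ne
  have hd := hN.1
  have ha := (hN.2 a).1 (by simp)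
  have hb := (hN.2 b).1 (by simp)
  have hc := (hN.2 c).1 (by simp)
  have hd' := (hN.2 d).1 (by simp)
  have hs := h.le_branchSum hv hN
  simp only [branchSum, add_zero] at hs
  have t1 := h.le_bound (k := 5) (P := []) ha.1 [] (by simp) (by grind) (by grind)
  have t2 := h.le_bound (k := 6) (P := [a]) hc.1 [a] (by grind) (by grind) (by grind)
  have t3 := h.le_bound (k := 6) (P := [c, a]) hb.1 [c] (by grind) (by grind) (by grind)
  have t4 := h.le_bound (k := 7) (P := [b, c, a]) hd'.1 [a, b] (by grind) (by grind) (by grind)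
  by_contra hcon
  rw [not_or] at hcon
  obtain ⟨hM, htri⟩ := hcon
  apply htri
  clear htri
  constructor
  · by_contra hn
    have hdeg := degOn_rest_add_length_le (G := G) (S := S) (w := b) (P := [a]) (u := c) [v, a]
      (by simp; grind) (by simp; grind)
    have t : f (rest G S [a] c) ≤ x ^ 9 * M + x ^ 10 * M :=
      h.le_bound_deg_two (k := 6) (P := [a]) (w := b) hc.1 [a] (by simp; grind) (by grind)
      (by grind) (by grind) hn
    have num := h.nums
    apply hM
    linarith
  · by_contra hn
    have hdeg := degOn_rest_add_length_le (G := G) (S := S) (w := d) (P := [c, a]) (u := b) [v, c]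
      (by simp; grind) (by simp; grind)
    have t : f (rest G S [c, a] b) ≤ x ^ 9 * M + x ^ 10 * M :=
      h.le_bound_deg_two (k := 6) (P := [c, a]) (w := d) hb.1 [c] (by simp; grind) (by grind)
      (by grind) (by grind) hn
    have num := h.nums
    apply hM
    linarith

/-- When all four neighbours have degree 4, the triangles of the previous lemma contain the two
further neighbours p, q of b and r, s of d. Either the link of b is a path, or p, q, r, s form a K₄.
-/
theorem le_of_matching_link (h : Step G f x M S) (hmin : ∀ y ∈ S, 4 ≤ degOn G S y)
    (hv : v ∈ S) (hN : Nbrs G S v [a, b, c, d]) (hab : G.Adj a b) (hcd : G.Adj c d)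
    (hac : ¬ G.Adj a c) (had : ¬ G.Adj a d)
    (hbc : ¬ G.Adj b c) (hbd : ¬ G.Adj b d) : f S ≤ M := by
  have sym := G.adj_comm
  have irr : ∀ u v, G.Adj u v → u ≠ v := fun _ _ h => h.ne
  have hdup := hN.1
  simp only [List.nodup_cons, List.mem_cons, List.not_mem_nil, not_or, or_false] at hdup
  have ha := (hN.2 a).1 (by simp)
  have hb := (hN.2 b).1 (by simp)
  have hc := (hN.2 c).1 (by simp)
  have hd := (hN.2 d).1 (by simp)
  by_cases a5 : 5 ≤ degOn G S a
  · exact h.le_of_matching_link_of_degOn hmin hv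
      (hN.congr (l' := [a, c, b, d]) (by simp; grind) (by simp; grind)) hac had hbc hbd a5
  by_cases b5 : 5 ≤ degOn G S b
  · exact h.le_of_matching_link_of_degOn hmin hv
      (hN.congr (l' := [b, c, a, d]) (by simp; grind) (by simp; grind)) hbc hbd hac had b5
  by_cases c5 : 5 ≤ degOn G S c
  · exact h.le_of_matching_link_of_degOn hmin hv
      (hN.congr (l' := [c, a, d, b]) (by simp; grind) (by simp; grind)) (by grind) (by grind)
      (by grind) (by grind) c5
  by_cases d5 : 5 ≤ degOn G S d
  · exact h.le_of_matching_link_of_degOn hmin hv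
      (hN.congr (l' := [d, a, c, b]) (by simp; grind) (by simp; grind)) (by grind) (by grind)
      (by grind) (by grind) d5
  obtain hM | ⟨⟨p, q, hpT, hqT, hbp, hbq, hpq, -, hp, hq⟩, ⟨r, s, hrT, hsT, hdr, hds, hrs, -⟩⟩ :=
    h.le_or_triangleOn_of_matching_link hmin hv
      (hN.congr (l' := [a, c, b, d]) (by simp; grind) (by simp; grind)) hab hcd hac had hbc hbd
      (by omega) (by omega)
  · exact hM
  -- Exchanging c and d shows that the triangle b, p, q is also a component once a and N[d] are
  -- removed.
  obtain hM | ⟨⟨p', q', hpT', hqT', hbp', hbq', hpq', -, hp', hq'⟩, -⟩ :=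
    h.le_or_triangleOn_of_matching_link hmin hv
      (hN.congr (l' := [a, d, b, c]) (by simp; grind) (by simp; grind)) hab hcd.symm had hac hbd hbc
      (by omega) (by omega)
  · exact hM
  rw [mem_rest] at hpT hqT hrT hsT hpT' hqT'
  simp only [List.mem_cons, List.not_mem_nil, not_or, or_false] at hpT hqT hrT hsT hpT' hqT'
  have nv : ∀ z ∈ S, G.Adj v z → z = a ∨ z = b ∨ z = c ∨ z = d := fun z hz hvz => by
    simpa using (hN.2 z).2 ⟨hz, hvz⟩
  have hNb : Nbrs G S b [v, a, p, q] :=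
    nbrs_of_degOn_le (by simp; grind) (by simp; grind) (by simp; omega)
  have hNd : Nbrs G S d [v, c, r, s] :=
    nbrs_of_degOn_le (by simp; grind) (by simp; grind) (by simp; omega)
  have nb : ∀ z ∈ S, G.Adj b z → z = v ∨ z = a ∨ z = p ∨ z = q := fun z hz hbz => by
    simpa using (hNb.2 z).2 ⟨hz, hbz⟩
  have nd : ∀ z ∈ S, G.Adj d z → z = v ∨ z = c ∨ z = r ∨ z = s := fun z hz hdz => by
    simpa using (hNd.2 z).2 ⟨hz, hdz⟩
  have hvp : ¬ G.Adj v p := by grind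
  have hvq : ¬ G.Adj v q := by grind
  by_cases hap : G.Adj a p
  · exact h.le_of_path_link hmin hb.1 hNb ha.2 hap hpq hvq hvp
      (fun haq => h.cliqueFree b a p q hab.symm hbp hbq hap haq hpq)
  by_cases haq : G.Adj a q
  · exact h.le_of_path_link hmin hb.1 (hNb.congr (l' := [v, a, q, p]) (by simp; grind)
      (by simp; grind)) ha.2 haq hpq.symm hvp hvq hap
  exfalso
  have swap : (p' = p ∧ q' = q) ∨ (p' = q ∧ q' = p) := by
    have := nb p' hpT'.1 hbp'
    have := nb q' hqT'.1 hbq'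
    grind
  -- Any neighbour of z other than b and t lies in both N(c) and N(d), hence is r or s; degree at
  -- least 4 makes z adjacent to both.
  have adj : ∀ z t, z ∈ S → G.Adj b z → G.Adj b t → G.Adj z t → ¬ G.Adj a z → ¬ G.Adj c z →
      ¬ G.Adj v z → ¬ G.Adj d z →
      (∀ y ∈ rest G S [a] c, G.Adj z y → y = b ∨ y = t) →
      (∀ y ∈ rest G S [a] d, G.Adj z y → y = b ∨ y = t) → G.Adj z r ∧ G.Adj z s := by
    intro z t hz hbz hbt hzt haz hcz hvz hdz h1 h2
    have key : ∀ y ∈ S, G.Adj z y → y = b ∨ y = t ∨ y = r ∨ y = s := by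
      intro y hy hzy
      have h1' := h1 y
      have h2' := h2 y
      rw [mem_rest] at h1' h2'
      simp only [List.mem_cons, List.not_mem_nil, or_false] at h1' h2'
      have := nd y hy
      grind
    obtain ⟨l, hNz, hl⟩ := exists_nbrs G S z
    have h4 := hmin z hz
    have hsub : l.toFinset ⊆ {b, t, r, s} := by
      intro y hy
      have := (hNz.2 y).1 (List.mem_toFinset.1 hy)
      simpa using key y this.1 this.2
    have hle : ({b, t, r, s} : Finset V).card ≤ 4 := card_le_four
    have heq := eq_of_subset_of_card_le hsub (by
      rw [List.toFinset_card_of_nodup hNz.1]; omega)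
    have hr := (hNz.2 r).1 (List.mem_toFinset.1 (by rw [heq]; simp))
    have hs := (hNz.2 s).1 (List.mem_toFinset.1 (by rw [heq]; simp))
    exact ⟨hr.2, hs.2⟩
  have hpd : ¬ G.Adj d p := by grind
  have hqd : ¬ G.Adj d q := by grind
  have hpr := adj p q hpT.1 hbp hbq hpq hap hpT.2.2.2 hvp hpd hp (by grind)
  have hqr := adj q p hqT.1 hbq hbp hpq.symm haq hqT.2.2.2 hvq hqd hq (by grind)
  exact h.cliqueFree p q r s hpq hpr.1 hpr.2 hqr.1 hqr.2 hrs

/-- The link of `v` contains the edge `ab`, and the edge `cd` or no other edge. -/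
theorem le_of_edge_link (h : Step G f x M S) (hmin : ∀ y ∈ S, 4 ≤ degOn G S y)
    (hv : v ∈ S) (hN : Nbrs G S v [a, b, c, d]) (hab : G.Adj a b)
    (hac : ¬ G.Adj a c) (had : ¬ G.Adj a d) (hbc : ¬ G.Adj b c) (hbd : ¬ G.Adj b d) :
    f S ≤ M := by
  have sym := G.adj_comm
  have hdup := hN.1
  simp only [List.nodup_cons, List.mem_cons, List.not_mem_nil, not_or, or_false] at hdup
  by_cases hcd : G.Adj c d
  · exact h.le_of_matching_link hmin hv hN hab hcd hac had hbc hbd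
  · exact h.le_of_sparse_link hmin hv (hN.congr (l' := [c, d, a, b]) (by simp; grind)
      (by simp; grind)) hcd (by grind) (by grind) (by grind) (by grind)

/-- The link of `v` consists of the path `a, b, c` and the isolated vertex `d`. -/
theorem le_of_cherry_link (h : Step G f x M S) (hmin : ∀ y ∈ S, 4 ≤ degOn G S y)
    (hv : v ∈ S) (hN : Nbrs G S v [d, a, c, b]) (hab : G.Adj a b) (hbc : G.Adj b c)
    (hac : ¬ G.Adj a c) (had : ¬ G.Adj a d) (hbd : ¬ G.Adj b d) (hcd : ¬ G.Adj c d) :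
    f S ≤ M := by
  have sym := G.adj_comm
  have irr : ∀ u v, G.Adj u v → u ≠ v := fun _ _ h => h.ne
  have hdup := hN.1
  simp only [List.nodup_cons, List.mem_cons, List.not_mem_nil, not_or, or_false] at hdup
  have ha := (hN.2 a).1 (by simp)
  have hb := (hN.2 b).1 (by simp)
  have hc := (hN.2 c).1 (by simp)
  have hd := (hN.2 d).1 (by simp)
  have hs := h.le_branchSum hv hN
  simp only [branchSum, add_zero] at hs
  have ma := hmin a ha.1
  have mb := hmin b hb.1
  have mc := hmin c hc.1
  have md := hmin d hd.1
  have key : ∀ i j k l : ℕ, i ≤ degOn G S d → j ≤ degOn G S a → k ≤ degOn G S c →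
      l ≤ degOn G S b →
      f S ≤ x ^ (i + 1) * M + x ^ (j + 2) * M + x ^ (k + 3) * M + x ^ (l + 2) * M := by
    intro i j k l hi hj hk hl
    have t1 := h.le_bound (k := i + 1) (P := []) hd.1 [] (by simp) (by omega) (by simp; omega)
    have t2 := h.le_bound (k := j + 2) (P := [d]) ha.1 [d] (by simp; grind) (by omega)
      (by simp; omega)
    have t3 := h.le_bound (k := k + 3) (P := [a, d]) hc.1 [a, d] (by simp; grind) (by omega)
      (by simp; omega)
    have t4 := h.le_bound (k := l + 2) (P := [c, a, d]) hb.1 [d] (by simp; grind) (by omega)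
      (by simp; omega)
    linarith
  -- Degrees 4 throughout give the exponents 5, 6, 7, 6, slightly too much; a single larger degree
  -- is enough.
  by_cases d5 : 5 ≤ degOn G S d
  · have := key 5 4 4 4 d5 ma mc mb
    have num := h.nums
    norm_num at this
    linarith
  by_cases a5 : 5 ≤ degOn G S a
  · have := key 4 5 4 4 md a5 mc mb
    have num := h.nums
    norm_num at this
    linarith
  by_cases c5 : 5 ≤ degOn G S c
  · have := key 4 4 5 4 md ma c5 mb
    have num := h.nums
    norm_num at this
    linarith
  by_cases b5 : 5 ≤ degOn G S b
  · have := key 4 4 4 5 md ma mc b5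
    have num := h.nums
    norm_num at this
    linarith
  clear key hs
  have nv : ∀ z ∈ S, G.Adj v z → z = d ∨ z = a ∨ z = c ∨ z = b := fun z hz hvz => by
    simpa using (hN.2 z).2 ⟨hz, hvz⟩
  obtain ⟨l, hNb, hlb⟩ := exists_nbrs_append (G := G) (S := S) (v := b) (l := [v, a, c])
    (by simp; grind) (by simp; grind)
  obtain ⟨p, rfl⟩ := List.length_eq_one_iff.1 (show l.length = 1 by simp at hlb; omega)
  simp only [List.cons_append, List.nil_append] at hNb
  have hp := (hNb.2 p).1 (by simp)
  have hdb := hNb.1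
  simp only [List.nodup_cons, List.mem_cons, List.not_mem_nil, not_or, or_false] at hdb
  have hvp : ¬ G.Adj v p := by grind
  -- Passing to the link of b, on v, a, c, p: it is a cycle or a path unless p is adjacent to
  -- neither a nor c. In that case the link of a has the edge vb and at most one other, disjoint
  -- from it.
  by_cases hap : G.Adj a p <;> by_cases hcp : G.Adj c p
  · exact h.le_of_cycle_link hmin hb.1 (hNb.congr (l' := [v, a, p, c]) (by simp; grind)
      (by simp; grind)) ha.2 hap hcp.symm hc.2 hvp hac
  · exact h.le_of_path_link hmin hb.1 (hNb.congr (l' := [p, a, v, c]) (by simp; grind)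
      (by simp; grind)) hap.symm ha.2.symm hc.2 (by grind) (by grind) hac
  · exact h.le_of_path_link hmin hb.1 (hNb.congr (l' := [p, c, v, a]) (by simp; grind)
      (by simp; grind)) hcp.symm hc.2.symm ha.2 (by grind) (by grind) (by grind)
  have nb : ∀ z ∈ S, G.Adj b z → z = v ∨ z = a ∨ z = c ∨ z = p := fun z hz hbz => by
    simpa using (hNb.2 z).2 ⟨hz, hbz⟩
  obtain ⟨l, hNa, hla⟩ := exists_nbrs_append (G := G) (S := S) (v := a) (l := [v, b])
    (by simp; grind) (by simp; grind)
  obtain ⟨q, r, rfl⟩ := List.length_eq_two.1 (show l.length = 2 by simp at hla; omega)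
  simp only [List.cons_append, List.nil_append] at hNa
  have hq := (hNa.2 q).1 (by simp)
  have hr := (hNa.2 r).1 (by simp)
  have hda := hNa.1
  simp only [List.nodup_cons, List.mem_cons, List.not_mem_nil, not_or, or_false] at hda
  have far : ∀ z, z ∈ S → G.Adj a z → z ≠ v → z ≠ b → ¬ G.Adj v z ∧ ¬ G.Adj b z := by
    intro z hz haz hzv hzb
    refine ⟨fun hvz => ?_, fun hbz => ?_⟩
    · have := nv z hz hvz
      grind
    · have := nb z hz hbz
      grind
  have fq := far q hq.1 hq.2 (by grind) (by grind)
  have fr := far r hr.1 hr.2 (by grind) (by grind)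
  exact h.le_of_edge_link hmin ha.1 hNa hb.2 fq.1 fr.1 fq.2 fr.2

/-- The link of `v` is a star with centre `b`. -/
theorem le_of_star_link (h : Step G f x M S) (hmin : ∀ y ∈ S, 4 ≤ degOn G S y)
    (hmax : ∀ y ∈ S, degOn G S y ≤ 5)
    (hv : v ∈ S) (hN : Nbrs G S v [a, c, d, b]) (hab : G.Adj a b) (hbc : G.Adj b c)
    (hbd : G.Adj b d) (hac : ¬ G.Adj a c) (had : ¬ G.Adj a d) (hcd : ¬ G.Adj c d) :
    f S ≤ M := by
  have sym := G.adj_comm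
  have irr : ∀ u v, G.Adj u v → u ≠ v := fun _ _ h => h.ne
  have main : ∀ a c, Nbrs G S v [a, c, d, b] → G.Adj a b → G.Adj b c → ¬ G.Adj a c →
      ¬ G.Adj a d → ¬ G.Adj c d → degOn G S a ≤ 4 → f S ≤ M := by
    intro a c hN hab hbc hac had hcd ha4
    have hdup := hN.1
    simp only [List.nodup_cons, List.mem_cons, List.not_mem_nil, not_or, or_false] at hdup
    have ha := (hN.2 a).1 (by simp)
    have hb := (hN.2 b).1 (by simp)
    have hc := (hN.2 c).1 (by simp)
    have hd := (hN.2 d).1 (by simp)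
    have ma := hmin a ha.1
    have nv : ∀ z ∈ S, G.Adj v z → z = a ∨ z = c ∨ z = d ∨ z = b := fun z hz hvz => by
      simpa using (hN.2 z).2 ⟨hz, hvz⟩
    obtain ⟨l, hNa, hla⟩ := exists_nbrs_append (G := G) (S := S) (v := a) (l := [v, b])
      (by simp; grind) (by simp; grind)
    obtain ⟨q, r, rfl⟩ := List.length_eq_two.1 (show l.length = 2 by simp at hla; omega)
    simp only [List.cons_append, List.nil_append] at hNa
    have hq := (hNa.2 q).1 (by simp)
    have hr := (hNa.2 r).1 (by simp)
    have hda := hNa.1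
    simp only [List.nodup_cons, List.mem_cons, List.not_mem_nil, not_or, or_false] at hda
    have hvq : ¬ G.Adj v q := by grind
    have hvr : ¬ G.Adj v r := by grind
    have one : ∀ q r, Nbrs G S a [v, b, q, r] → q ∈ S → ¬ G.Adj v q → ¬ G.Adj v r → G.Adj b q →
        ¬ G.Adj b r → f S ≤ M := by
      intro q r hNa hqS hvq hvr hbq hbr
      have hda := hNa.1
      simp only [List.nodup_cons, List.mem_cons, List.not_mem_nil, not_or, or_false] at hda
      by_cases hqr : G.Adj q r
      · exact h.le_of_path_link hmin ha.1 hNa hb.2 hbq hqr hvr hvq hbr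
      · exact h.le_of_cherry_link hmin ha.1 (hNa.congr (l' := [r, v, q, b]) (by simp; grind)
          (by simp; grind)) hb.2 hbq hvq hvr hbr hqr
    -- The link of a contains the edge vb, and v is adjacent to neither q nor r. If b is adjacent to
    -- both, its degree is at least 6; if to one, the link is a path or a cherry; if to none, an
    -- edge link.
    by_cases hbq : G.Adj b q <;> by_cases hbr : G.Adj b r
    · exfalso
      have hmb := hmax b hb.1
      have := length_le_degOn (G := G) (S := S) (v := b) (l := [v, a, c, d, q, r])
        (by simp; grind) (by simp; grind)
      simp at this
      omega
    · exact one q r hNa hq.1 hvq hvr hbq hbr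
    · exact one r q (hNa.congr (by simp; grind) (by simp; grind)) hr.1 hvr hvq hbr hbq
    · exact h.le_of_edge_link hmin ha.1 hNa hb.2 hvq hvr hbq hbr
  have hdup := hN.1
  simp only [List.nodup_cons, List.mem_cons, List.not_mem_nil, not_or, or_false] at hdup
  by_cases a4 : degOn G S a ≤ 4
  · exact main a c hN hab hbc hac had hcd a4
  by_cases c4 : degOn G S c ≤ 4
  · exact main c a (hN.congr (by simp; grind) (by simp; grind)) hbc.symm hab.symm (by grind) hcd
      had c4
  have ha := (hN.2 a).1 (by simp)
  have hb := (hN.2 b).1 (by simp)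
  have hc := (hN.2 c).1 (by simp)
  have hd := (hN.2 d).1 (by simp)
  have mb := hmin b hb.1
  have md := hmin d hd.1
  have hs := h.le_branchSum hv hN
  simp only [branchSum, add_zero] at hs
  -- Two leaves of the star have degree at least 5, which gives the exponents 6, 7, 7, 5.
  have t1 := h.le_bound (k := 6) (P := []) ha.1 [] (by simp) (by omega) (by simp; omega)
  have t2 := h.le_bound (k := 7) (P := [a]) hc.1 [a] (by simp; grind) (by omega) (by simp; omega)
  have t3 := h.le_bound (k := 7) (P := [c, a]) hd.1 [a, c] (by simp; grind) (by omega)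
    (by simp; omega)
  have t4 := h.le_bound (k := 5) (P := [d, c, a]) hb.1 [] (by simp) (by omega) (by simp; omega)
  have num := h.nums
  linarith

/-- In the link of `v`, the vertex `b` has the neighbours `a` and `c`. -/
theorem le_of_two_edges_link (h : Step G f x M S) (hmin : ∀ y ∈ S, 4 ≤ degOn G S y)
    (hmax : ∀ y ∈ S, degOn G S y ≤ 5)
    (hv : v ∈ S) (hN : Nbrs G S v [b, a, c, d]) (hab : G.Adj b a) (hbc : G.Adj b c) :
    f S ≤ M := by
  have sym := G.adj_comm
  have hdup := hN.1
  simp only [List.nodup_cons, List.mem_cons, List.not_mem_nil, not_or, or_false] at hdup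
  have ha := (hN.2 a).1 (by simp)
  have hb := (hN.2 b).1 (by simp)
  have hc := (hN.2 c).1 (by simp)
  have hd := (hN.2 d).1 (by simp)
  have hac : ¬ G.Adj a c := h.cliqueFree v b a c hb.2 ha.2 hc.2 hab hbc
  by_cases hbd : G.Adj b d
  · exact h.le_of_star_link hmin hmax hv (hN.congr (l' := [a, c, d, b]) (by simp; grind)
      (by simp; grind)) hab.symm hbc hbd hac (h.cliqueFree v b a d hb.2 ha.2 hd.2 hab hbd)
      (h.cliqueFree v b c d hb.2 hc.2 hd.2 hbc hbd)
  by_cases had : G.Adj a d <;> by_cases hcd : G.Adj c d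
  · exact h.le_of_cycle_link hmin hv (hN.congr (l' := [a, b, c, d]) (by simp; grind)
      (by simp; grind)) hab.symm hbc hcd had hac hbd
  · exact h.le_of_path_link hmin hv (hN.congr (l' := [d, a, b, c]) (by simp; grind)
      (by simp; grind)) had.symm hab.symm hbc (by grind) (by grind) hac
  · exact h.le_of_path_link hmin hv (hN.congr (l' := [a, b, c, d]) (by simp; grind)
      (by simp; grind)) hab.symm hbc hcd had hac hbd
  · exact h.le_of_cherry_link hmin hv (hN.congr (l' := [d, a, c, b]) (by simp; grind)
      (by simp; grind)) hab.symm hbc hac had hbd hcd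

theorem le_of_adj_link (h : Step G f x M S) (hmin : ∀ y ∈ S, 4 ≤ degOn G S y)
    (hmax : ∀ y ∈ S, degOn G S y ≤ 5)
    (hv : v ∈ S) (hN : Nbrs G S v [a, b, c, d]) (hab : G.Adj a b) : f S ≤ M := by
  have hdup := hN.1
  simp only [List.nodup_cons, List.mem_cons, List.not_mem_nil, not_or, or_false] at hdup
  by_cases hac : G.Adj a c
  · exact h.le_of_two_edges_link hmin hmax hv hN hab hac
  by_cases had : G.Adj a d
  · exact h.le_of_two_edges_link hmin hmax hv (hN.congr (l' := [a, b, d, c]) (by simp; grind)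
      (by simp; grind)) hab had
  by_cases hbc : G.Adj b c
  · exact h.le_of_two_edges_link hmin hmax hv (hN.congr (l' := [b, a, c, d]) (by simp; grind)
      (by simp; grind)) hab.symm hbc
  by_cases hbd : G.Adj b d
  · exact h.le_of_two_edges_link hmin hmax hv (hN.congr (l' := [b, a, d, c]) (by simp; grind)
      (by simp; grind)) hab.symm hbd
  exact h.le_of_edge_link hmin hv hN hab hac had hbc hbd

theorem le_of_degOn_four (h : Step G f x M S) (hmin : ∀ y ∈ S, 4 ≤ degOn G S y)
    (hmax : ∀ y ∈ S, degOn G S y ≤ 5) (hv : v ∈ S) (h4 : degOn G S v = 4) : f S ≤ M := by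
  obtain ⟨l, hN, hl⟩ := exists_nbrs G S v
  rw [h4] at hl
  match l, hN, hl with
  | [a, b, c, d], hN, _ =>
    have hdup := hN.1
    simp only [List.nodup_cons, List.mem_cons, List.not_mem_nil, not_or, or_false] at hdup
    by_cases hab : G.Adj a b
    · exact h.le_of_adj_link hmin hmax hv hN hab
    by_cases hac : G.Adj a c
    · exact h.le_of_adj_link hmin hmax hv (hN.congr (l' := [a, c, b, d]) (by simp; grind)
        (by simp; grind)) hac
    by_cases had : G.Adj a d
    · exact h.le_of_adj_link hmin hmax hv (hN.congr (l' := [a, d, b, c]) (by simp; grind)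
        (by simp; grind)) had
    by_cases hbc : G.Adj b c
    · exact h.le_of_adj_link hmin hmax hv (hN.congr (l' := [b, c, a, d]) (by simp; grind)
        (by simp; grind)) hbc
    by_cases hbd : G.Adj b d
    · exact h.le_of_adj_link hmin hmax hv (hN.congr (l' := [b, d, a, c]) (by simp; grind)
        (by simp; grind)) hbd
    exact h.le_of_sparse_link hmin hv hN hab hac had hbc hbd

end Step

end Branching

end SimpleGraph

/-! ### Five-regular graphs -/

namespace SimpleGraph

namespace Branching

set_option linter.unusedSectionVars false

open Finset

variable {V : Type u} [DecidableEq V] {G : SimpleGraph V} [DecidableRel G.Adj]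
  {S T : Finset V} {u v w y a b c d e : V} {f : Finset V → ℝ} {x M : ℝ}

theorem degOn_le_length {l : List V} (h : ∀ y ∈ S, G.Adj v y → y ∈ l) :
    degOn G S v ≤ l.length := by
  refine (card_le_card (t := l.toFinset) fun y hy => ?_).trans (List.toFinset_card_le l)
  rw [mem_filter] at hy
  exact List.mem_toFinset.2 (h y hy.1 hy.2)

namespace Step

/-- The link is the four-cycle c, a, w, b with d pendant at c. The exponents 6, 7, 7, 7, 8 give
about 1.003. After the removal of N[c] the vertex w keeps at most two neighbours, which improves the
first term unless w lies in a triangle w, y, z; in that case the second term improves instead. -/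
theorem le_of_banner_link (h : Step G f x M S) (hreg : ∀ y ∈ S, degOn G S y = 5) (hv : v ∈ S)
    (hN : Nbrs G S v [c, w, d, a, b]) (hca : G.Adj c a) (hcb : G.Adj c b) (hcd : G.Adj c d)
    (hwa : G.Adj w a) (hwb : G.Adj w b) (hwd : ¬ G.Adj w d) (hcw : ¬ G.Adj c w)
    (hab : ¬ G.Adj a b) (had : ¬ G.Adj a d) (hbd : ¬ G.Adj b d) : f S ≤ M := by
  have sym := G.adj_comm
  have irr : ∀ u v, G.Adj u v → u ≠ v := fun _ _ h => h.ne
  have hdup := hN.1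
  simp only [List.nodup_cons, List.mem_cons, List.not_mem_nil, not_or, or_false] at hdup
  have ha := (hN.2 a).1 (by simp)
  have hb := (hN.2 b).1 (by simp)
  have hc := (hN.2 c).1 (by simp)
  have hd := (hN.2 d).1 (by simp)
  have hw := (hN.2 w).1 (by simp)
  have hs := h.le_branchSum hv hN
  simp only [branchSum, add_zero] at hs
  have ra := hreg a ha.1
  have rb := hreg b hb.1
  have rc := hreg c hc.1
  have rd := hreg d hd.1
  have rw' := hreg w hw.1
  have t3 := h.le_bound (k := 7) (P := [w, c]) hd.1 [w] (by simp; grind) (by omega)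
    (by simp; omega)
  have t4 := h.le_bound (k := 7) (P := [d, w, c]) ha.1 [d] (by simp; grind) (by omega)
    (by simp; omega)
  have t5 := h.le_bound (k := 8) (P := [a, d, w, c]) hb.1 [a, d] (by simp; grind) (by omega)
    (by simp; omega)
  have hdeg := degOn_rest_add_length_le (G := G) (S := S) (w := w) (P := []) (u := c) [v, a, b]
    (by simp; grind) (by simp; grind)
  by_cases htri : TriangleOn G (rest G S [] c) w
  swap
  · have t1 : f (rest G S [] c) ≤ x ^ 9 * M + x ^ 10 * M :=
      h.le_bound_deg_two (k := 6) (w := w) hc.1 [] (by simp) (by simp; omega) (by grind)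
        (by simp at hdeg; omega) htri
    have t2 := h.le_bound (k := 7) (P := [c]) hw.1 [c] (by simp; grind) (by omega)
      (by simp; omega)
    have num := h.nums
    linarith
  have t1 := h.le_bound (k := 6) (P := []) hc.1 [] (by simp) (by omega) (by simp; omega)
  obtain ⟨y, z, hyT, hzT, hwy, hwz, hyz, -, hy, hz⟩ := htri
  rw [mem_rest] at hyT hzT
  simp only [List.not_mem_nil, not_false_eq_true, true_and] at hyT hzT
  obtain ⟨l, hNc, hlc⟩ := exists_nbrs_append (G := G) (S := S) (v := c) (l := [v, a, b, d])
    (by simp; grind) (by simp; grind)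
  obtain ⟨t, rfl⟩ := List.length_eq_one_iff.1 (show l.length = 1 by simp at hlc; omega)
  simp only [List.cons_append, List.nil_append] at hNc
  have nc : ∀ z ∈ S, G.Adj c z → z = v ∨ z = a ∨ z = b ∨ z = d ∨ z = t := fun z hz hcz => by
    simpa using (hNc.2 z).2 ⟨hz, hcz⟩
  have nv : ∀ z ∈ S, G.Adj v z → z = c ∨ z = w ∨ z = d ∨ z = a ∨ z = b := fun z hz hvz => by
    simpa using (hN.2 z).2 ⟨hz, hvz⟩
  have near : ∀ y z, y ∈ S → y ≠ c → ¬ G.Adj c y → G.Adj w y →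
      (∀ q ∈ rest G S [] c, G.Adj y q → q = w ∨ q = z) →
      ∀ q ∈ S, G.Adj y q → q = w ∨ q = z ∨ q = a ∨ q = b ∨ q = d ∨ q = t := by
    intro y z hyS hyc hcy hwy hy q hq hyq
    have h1 := hy q
    rw [mem_rest] at h1
    simp only [List.not_mem_nil, not_false_eq_true, true_and] at h1
    have h2 := nc q hq
    have h3 := nv y hyS
    grind
  have ny := near y z hyT.1 hyT.2.1 hyT.2.2 hwy hy
  have nz := near z y hzT.1 hzT.2.1 hzT.2.2 hwz hz
  -- By K₄-freeness y and z share neither a nor b as a neighbour.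
  have ka : ¬ (G.Adj y a ∧ G.Adj z a) := fun hyza =>
    h.cliqueFree w y z a hwy hwz hwa hyz hyza.1 hyza.2
  have kb : ¬ (G.Adj y b ∧ G.Adj z b) := fun hyzb =>
    h.cliqueFree w y z b hwy hwz hwb hyz hyzb.1 hyzb.2
  have toD : ∀ y z, y ∈ S → z ∈ S →
      (∀ q ∈ S, G.Adj y q → q = w ∨ q = z ∨ q = a ∨ q = b ∨ q = d ∨ q = t) →
      (∀ q ∈ S, G.Adj z q → q = w ∨ q = y ∨ q = a ∨ q = b ∨ q = d ∨ q = t) →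
      ¬ (G.Adj y a ∧ G.Adj z a) → ¬ (G.Adj y b ∧ G.Adj z b) → G.Adj y d := by
    -- If y were not adjacent to d, its degree 5 would force a and b among its neighbours, leaving z
    -- only w, y, d, t.
    intro y z hyS hzS ny nz ka kb
    by_contra hyd
    have ry := hreg y hyS
    have rz := hreg z hzS
    have hya : G.Adj y a := by
      by_contra hya
      have := degOn_le_length (G := G) (S := S) (v := y) (l := [w, z, b, t])
        (fun q hq hyq => by have := ny q hq hyq; simp; grind)
      simp at this
      omega
    have hyb : G.Adj y b := by
      by_contra hyb
      have := degOn_le_length (G := G) (S := S) (v := y) (l := [w, z, a, t])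
        (fun q hq hyq => by have := ny q hq hyq; simp; grind)
      simp at this
      omega
    have := degOn_le_length (G := G) (S := S) (v := z) (l := [w, y, d, t])
      (fun q hq hzq => by have := nz q hq hzq; simp; grind)
    simp at this
    omega
  have hyd := toD y z hyT.1 hzT.1 ny nz ka kb
  have hzd := toD z y hzT.1 hyT.1 nz ny (fun k => ka k.symm) (fun k => kb k.symm)
  -- Both y and z are adjacent to d, so removing c and N[w] costs d the neighbours v, c, y, z; the
  -- resulting leaf raises the exponent of w from 7 to 9.
  have hdeg2 := degOn_rest_add_length_le (G := G) (S := S) (w := d) (P := [c]) (u := w)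
    [v, c, y, z] (by simp; grind) (by simp; grind)
  have t2 := h.le_bound_leaf (k := 9) (w := d) (P := [c]) hw.1 [c] (by simp; grind) (by omega)
    (by simp; omega) (by grind) (by simp at hdeg2; omega)
  have num := h.nums
  linarith

/-- In the link of `v`, the vertex `c` has the neighbours `a`, `b`, `d`. -/
theorem le_of_three_edges_link (h : Step G f x M S) (hreg : ∀ y ∈ S, degOn G S y = 5) (hv : v ∈ S)
    (hN : Nbrs G S v [c, a, b, d, w]) (hca : G.Adj c a) (hcb : G.Adj c b) (hcd : G.Adj c d) :
    f S ≤ M := by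
  have sym := G.adj_comm
  have irr : ∀ u v, G.Adj u v → u ≠ v := fun _ _ h => h.ne
  have hdup := hN.1
  simp only [List.nodup_cons, List.mem_cons, List.not_mem_nil, not_or, or_false] at hdup
  have ha := (hN.2 a).1 (by simp)
  have hb := (hN.2 b).1 (by simp)
  have hc := (hN.2 c).1 (by simp)
  have hd := (hN.2 d).1 (by simp)
  have hw := (hN.2 w).1 (by simp)
  have ra := hreg a ha.1
  have rb := hreg b hb.1
  have rc := hreg c hc.1
  have rd := hreg d hd.1
  have rw' := hreg w hw.1
  have hab : ¬ G.Adj a b := h.cliqueFree v c a b hc.2 ha.2 hb.2 hca hcb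
  have had : ¬ G.Adj a d := h.cliqueFree v c a d hc.2 ha.2 hd.2 hca hcd
  have hbd : ¬ G.Adj b d := h.cliqueFree v c b d hc.2 hb.2 hd.2 hcb hcd
  -- The vertices a, b, d are pairwise nonadjacent. If w is also adjacent to c, the link is a star
  -- and the order with c last gives 6, 7, 8, 9, 6. Otherwise the number of neighbours of w among a,
  -- b, d decides: at most one is `sparse`, two is the banner, and three makes w a leaf after the
  -- removal of N[c].
  by_cases hcw : G.Adj c w
  · have haw : ¬ G.Adj a w := h.cliqueFree v c a w hc.2 ha.2 hw.2 hca hcw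
    have hbw : ¬ G.Adj b w := h.cliqueFree v c b w hc.2 hb.2 hw.2 hcb hcw
    have hdw : ¬ G.Adj d w := h.cliqueFree v c d w hc.2 hd.2 hw.2 hcd hcw
    have hs := h.le_branchSum hv (hN.congr (l' := [a, b, d, w, c]) (by simp; grind)
      (by simp; grind))
    simp only [branchSum, add_zero] at hs
    have t1 := h.le_bound (k := 6) (P := []) ha.1 [] (by simp) (by omega) (by simp; omega)
    have t2 := h.le_bound (k := 7) (P := [a]) hb.1 [a] (by simp; grind) (by omega)
      (by simp; omega)
    have t3 := h.le_bound (k := 8) (P := [b, a]) hd.1 [a, b] (by simp; grind) (by omega)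
      (by simp; omega)
    have t4 := h.le_bound (k := 9) (P := [d, b, a]) hw.1 [a, b, d] (by simp; grind) (by omega)
      (by simp; omega)
    have t5 := h.le_bound (k := 6) (P := [w, d, b, a]) hc.1 [] (by simp) (by omega) (by simp; omega)
    have num := h.nums
    linarith
  have sparse : ∀ a b d, Nbrs G S v [c, w, a, b, d] → ¬ G.Adj a b → ¬ G.Adj a d → ¬ G.Adj b d →
      ¬ G.Adj w a → ¬ G.Adj w b → f S ≤ M := by
    intro a b d hN hab had hbd hwa hwb
    have hdup := hN.1
    simp only [List.nodup_cons, List.mem_cons, List.not_mem_nil, not_or, or_false] at hdup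
    have ha := (hN.2 a).1 (by simp)
    have hb := (hN.2 b).1 (by simp)
    have hd := (hN.2 d).1 (by simp)
    have ra := hreg a ha.1
    have rb := hreg b hb.1
    have rd := hreg d hd.1
    have hs := h.le_branchSum hv hN
    simp only [branchSum, add_zero] at hs
    have t1 := h.le_bound (k := 6) (P := []) hc.1 [] (by simp) (by omega) (by simp; omega)
    have t2 := h.le_bound (k := 7) (P := [c]) hw.1 [c] (by simp; grind) (by omega)
      (by simp; omega)
    have t3 := h.le_bound (k := 7) (P := [w, c]) ha.1 [w] (by simp; grind) (by omega)
      (by simp; omega)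
    have t4 := h.le_bound (k := 8) (P := [a, w, c]) hb.1 [w, a] (by simp; grind) (by omega)
      (by simp; omega)
    have t5 := h.le_bound (k := 8) (P := [b, a, w, c]) hd.1 [a, b] (by simp; grind) (by omega)
      (by simp; omega)
    have num := h.nums
    linarith
  by_cases hwa : G.Adj w a <;> by_cases hwb : G.Adj w b <;> by_cases hwd : G.Adj w d
  · have hs := h.le_branchSum hv (hN.congr (l' := [c, w, a, b, d]) (by simp; grind)
      (by simp; grind))
    simp only [branchSum, add_zero] at hs
    have hdeg := degOn_rest_add_length_le (G := G) (S := S) (w := w) (P := []) (u := c)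
      [v, a, b, d] (by simp; grind) (by simp; grind)
    have t1 := h.le_bound_leaf (k := 8) (w := w) (P := []) hc.1 [] (by simp) (by omega)
      (by simp; omega) (by grind) (by simp at hdeg; omega)
    have t2 := h.le_bound (k := 7) (P := [c]) hw.1 [c] (by simp; grind) (by omega)
      (by simp; omega)
    have t3 := h.le_bound (k := 6) (P := [w, c]) ha.1 [] (by simp) (by omega) (by simp; omega)
    have t4 := h.le_bound (k := 7) (P := [a, w, c]) hb.1 [a] (by simp; grind) (by omega)
      (by simp; omega)
    have t5 := h.le_bound (k := 8) (P := [b, a, w, c]) hd.1 [a, b] (by simp; grind) (by omega)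
      (by simp; omega)
    have num := h.nums
    linarith
  · exact h.le_of_banner_link hreg hv (hN.congr (l' := [c, w, d, a, b]) (by simp; grind)
      (by simp; grind)) hca hcb hcd hwa hwb hwd hcw hab had hbd
  · exact h.le_of_banner_link hreg hv (hN.congr (l' := [c, w, b, a, d]) (by simp; grind)
      (by simp; grind)) hca hcd hcb hwa hwd hwb hcw had hab (by grind)
  · exact sparse b d a (hN.congr (by simp; grind) (by simp; grind)) hbd (by grind) (by grind)
      hwb hwd
  · exact h.le_of_banner_link hreg hv (hN.congr (l' := [c, w, a, b, d]) (by simp; grind)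
      (by simp; grind)) hcb hcd hca hwb hwd hwa hcw hbd (by grind) (by grind)
  · exact sparse a d b (hN.congr (by simp; grind) (by simp; grind)) had hab (by grind) hwa hwd
  · exact sparse a b d (hN.congr (by simp; grind) (by simp; grind)) hab had hbd hwa hwb
  · exact sparse a b d (hN.congr (by simp; grind) (by simp; grind)) hab had hbd hwa hwb

/-- The link of `v` is a five-cycle; `a, b, c, d, e` is the complementary cycle. -/
theorem le_of_pentagon_link (h : Step G f x M S) (hreg : ∀ y ∈ S, degOn G S y = 5) (hv : v ∈ S)
    (hN : Nbrs G S v [a, b, c, d, e]) (hac : G.Adj a c) (hbd : G.Adj b d) (hce : G.Adj c e)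
    (had : G.Adj a d) (hbe : G.Adj b e) (hab : ¬ G.Adj a b) (hbc : ¬ G.Adj b c)
    (hcd : ¬ G.Adj c d) (hde : ¬ G.Adj d e) (hae : ¬ G.Adj a e) : f S ≤ M := by
  have sym := G.adj_comm
  have irr : ∀ u v, G.Adj u v → u ≠ v := fun _ _ h => h.ne
  have hdup := hN.1
  simp only [List.nodup_cons, List.mem_cons, List.not_mem_nil, not_or, or_false] at hdup
  have ha := (hN.2 a).1 (by simp)
  have hb := (hN.2 b).1 (by simp)
  have hc := (hN.2 c).1 (by simp)
  have hd := (hN.2 d).1 (by simp)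
  have he := (hN.2 e).1 (by simp)
  have ra := hreg a ha.1
  have rb := hreg b hb.1
  have rc := hreg c hc.1
  have rd := hreg d hd.1
  have re := hreg e he.1
  have hs := h.le_branchSum hv hN
  simp only [branchSum, add_zero] at hs
  have t1 := h.le_bound (k := 6) (P := []) ha.1 [] (by simp) (by omega) (by simp; omega)
  have t2 := h.le_bound (k := 7) (P := [a]) hb.1 [a] (by simp; grind) (by omega)
    (by simp; omega)
  have t3 := h.le_bound (k := 7) (P := [b, a]) hc.1 [b] (by simp; grind) (by omega)
    (by simp; omega)
  have t4 := h.le_bound (k := 7) (P := [c, b, a]) hd.1 [c] (by simp; grind) (by omega)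
    (by simp; omega)
  have t5 := h.le_bound (k := 8) (P := [d, c, b, a]) he.1 [a, d] (by simp; grind) (by omega)
    (by simp; omega)
  -- The exponents 6, 7, 7, 7, 8 give about 1.003, so improving any one of the terms of a, b, d
  -- suffices. In these b, c, e respectively have few neighbours left, so each must lie in a
  -- triangle component.
  by_cases tri1 : TriangleOn G (rest G S [] a) b
  swap
  · have hdeg := degOn_rest_add_length_le (G := G) (S := S) (w := b) (P := []) (u := a) [v, d]
      (by simp; grind) (by simp; grind)
    have t1 : f (rest G S [] a) ≤ x ^ 10 * M + x ^ 11 * M + x ^ 12 * M :=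
      h.le_bound_low (k := 6) (w := b) ha.1 [] (by simp) (by omega) (by simp; omega) (by grind)
        (by simp at hdeg; omega) tri1
    have num := h.nums
    linarith
  by_cases tri2 : TriangleOn G (rest G S [a] b) c
  swap
  · have hdeg := degOn_rest_add_length_le (G := G) (S := S) (w := c) (P := [a]) (u := b) [v, a, e]
      (by simp; grind) (by simp; grind)
    have t2 : f (rest G S [a] b) ≤ x ^ 10 * M + x ^ 11 * M :=
      h.le_bound_deg_two (k := 7) (w := c) hb.1 [a] (by simp; grind) (by simp; omega) (by grind)
        (by simp at hdeg; omega) tri2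
    have num := h.nums
    linarith
  by_cases tri4 : TriangleOn G (rest G S [c, b, a] d) e
  swap
  · have hdeg := degOn_rest_add_length_le (G := G) (S := S) (w := e) (P := [c, b, a]) (u := d)
      [v, b, c] (by simp; grind) (by simp; grind)
    have t4 : f (rest G S [c, b, a] d) ≤ x ^ 10 * M + x ^ 11 * M :=
      h.le_bound_deg_two (k := 7) (w := e) hd.1 [c] (by simp; grind) (by simp; omega) (by grind)
        (by simp at hdeg; omega) tri4
    have num := h.nums
    linarith
  exfalso
  clear t1 t2 t3 t4 t5 hs
  have heT : e ∈ rest G S [] a := by grind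
  -- Since e is a neighbour of b outside N[a], the first triangle is b, e, w. Outside N(a) the
  -- vertex w is adjacent only to b and e.
  obtain ⟨w, hwT, hbw, hew, hw⟩ : ∃ w ∈ rest G S [] a, G.Adj b w ∧ G.Adj e w ∧
      ∀ y ∈ rest G S [] a, G.Adj w y → y = b ∨ y = e := by
    obtain ⟨p, q, hpT, hqT, hbp, hbq, hpq, h1, h2, h3⟩ := tri1
    rcases h1 e heT hbe with rfl | rfl
    · exact ⟨q, hqT, hbq, hpq, h3⟩
    · exact ⟨p, hpT, hbp, hpq.symm, h2⟩
  obtain ⟨g, k, hgT, hkT, hcg, hck, hgk, -⟩ := tri2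
  obtain ⟨i, j, hiT, hjT, hei, hej, hij, -⟩ := tri4
  rw [mem_rest] at hwT hgT hkT hiT hjT
  simp only [List.mem_cons, List.not_mem_nil, not_or, or_false, not_false_eq_true, true_and]
    at hwT hgT hkT hiT hjT
  have hNc : Nbrs G S c [v, a, e, g, k] :=
    nbrs_of_degOn_le (by simp; grind) (by simp; grind) (by simp; omega)
  have hNe : Nbrs G S e [v, b, c, i, j] :=
    nbrs_of_degOn_le (by simp; grind) (by simp; grind) (by simp; omega)
  obtain ⟨l, hNa, hla⟩ := exists_nbrs_append (G := G) (S := S) (v := a) (l := [v, c, d])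
    (by simp; grind) (by simp; grind)
  obtain ⟨r, s, rfl⟩ := List.length_eq_two.1 (show l.length = 2 by simp at hla; omega)
  simp only [List.cons_append, List.nil_append] at hNa
  have hwv : ¬ G.Adj w v := fun hwv => by
    have := (hN.2 w).2 ⟨hwT.1, hwv.symm⟩
    simp only [List.mem_cons, List.not_mem_nil, or_false] at this
    grind
  -- The neighbours of c are v, a, e and g, k, and neither g nor k is adjacent to b, whereas w is.
  have hwc : ¬ G.Adj w c := fun hwc => by
    have := (hNc.2 w).2 ⟨hwT.1, hwc.symm⟩
    simp only [List.mem_cons, List.not_mem_nil, or_false] at this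
    grind
  -- As a neighbour of e, w must be i or j, and these are not adjacent to d.
  have hwd : ¬ G.Adj w d := fun hwd => by
    have := (hNe.2 w).2 ⟨hwT.1, hew⟩
    simp only [List.mem_cons, List.not_mem_nil, or_false] at this
    grind
  -- In N(a) only r and s remain for w, so its degree is at most 4, against regularity.
  have := degOn_le_length (G := G) (S := S) (v := w) (l := [b, e, r, s]) (fun q hq hwq => by
    have h1 := hw q
    have h2 := (hNa.2 q).2
    rw [mem_rest] at h1
    simp only [List.mem_cons, List.not_mem_nil, or_false, not_false_eq_true, true_and] at h1 h2 ⊢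
    grind)
  have rw' := hreg w hwT.1
  simp at this
  omega

/-- In the link of `v`, the vertex `w` is not adjacent to `a`, `b`, `c`, and neither are `a`, `b`. -/
theorem le_of_nonadj_link_aux (h : Step G f x M S) (hreg : ∀ y ∈ S, degOn G S y = 5) (hv : v ∈ S)
    (hN : Nbrs G S v [w, a, b, c, d]) (hwa : ¬ G.Adj w a) (hwb : ¬ G.Adj w b)
    (hwc : ¬ G.Adj w c) (hab : ¬ G.Adj a b) : f S ≤ M := by
  have sym := G.adj_comm
  have hdup := hN.1
  simp only [List.nodup_cons, List.mem_cons, List.not_mem_nil, not_or, or_false] at hdup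
  have ha := (hN.2 a).1 (by simp)
  have hb := (hN.2 b).1 (by simp)
  have hc := (hN.2 c).1 (by simp)
  have hd := (hN.2 d).1 (by simp)
  have hw := (hN.2 w).1 (by simp)
  have ra := hreg a ha.1
  have rb := hreg b hb.1
  have rc := hreg c hc.1
  have rd := hreg d hd.1
  have rw' := hreg w hw.1
  have hs := h.le_branchSum hv hN
  simp only [branchSum, add_zero] at hs
  have t1 := h.le_bound (k := 6) (P := []) hw.1 [] (by simp) (by omega) (by simp; omega)
  have t2 := h.le_bound (k := 7) (P := [w]) ha.1 [w] (by simp; grind) (by omega)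
    (by simp; omega)
  have t3 := h.le_bound (k := 8) (P := [a, w]) hb.1 [w, a] (by simp; grind) (by omega)
    (by simp; omega)
  have t4 := h.le_bound (k := 7) (P := [b, a, w]) hc.1 [w] (by simp; grind) (by omega)
    (by simp; omega)
  -- After the exponents 6, 7, 8, 7 the vertex d must contribute 8, that is, have two nonneighbours
  -- among w, a, b, c. Otherwise it has three neighbours in the link.
  have fin : ∀ i ∈ [c, b, a, w], ∀ j ∈ [c, b, a, w], i ≠ j → ¬ G.Adj d i → ¬ G.Adj d j →
      f S ≤ M := by
    intro i hi j hj hij hdi hdj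
    have hiS : i ∈ S ∧ i ≠ d := by
      simp only [List.mem_cons, List.not_mem_nil, or_false] at hi
      rcases hi with rfl | rfl | rfl | rfl <;> grind
    have hjS : j ∈ S ∧ j ≠ d := by
      simp only [List.mem_cons, List.not_mem_nil, or_false] at hj
      rcases hj with rfl | rfl | rfl | rfl <;> grind
    have t5 := h.le_bound (k := 8) (P := [c, b, a, w]) hd.1 [i, j] ⟨by simp [hij], by
      rw [List.forall_mem_cons, List.forall_mem_singleton]
      exact ⟨⟨hiS.1, hi, hiS.2, hdi⟩, hjS.1, hj, hjS.2, hdj⟩⟩ (by omega) (by simp; omega)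
    have num := h.nums
    linarith
  by_cases hdw : G.Adj d w <;> by_cases hda : G.Adj d a <;> by_cases hdb : G.Adj d b
  · exact h.le_of_three_edges_link hreg hv (hN.congr (l' := [d, w, a, b, c]) (by simp; grind)
      (by simp; grind)) hdw hda hdb
  · by_cases hdc : G.Adj d c
    · exact h.le_of_three_edges_link hreg hv (hN.congr (l' := [d, w, a, c, b]) (by simp; grind)
        (by simp; grind)) hdw hda hdc
    · exact fin b (by simp) c (by simp) (by grind) hdb hdc
  · by_cases hdc : G.Adj d c
    · exact h.le_of_three_edges_link hreg hv (hN.congr (l' := [d, w, b, c, a]) (by simp; grind)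
        (by simp; grind)) hdw hdb hdc
    · exact fin a (by simp) c (by simp) (by grind) hda hdc
  · exact fin a (by simp) b (by simp) (by grind) hda hdb
  · by_cases hdc : G.Adj d c
    · exact h.le_of_three_edges_link hreg hv (hN.congr (l' := [d, a, b, c, w]) (by simp; grind)
        (by simp; grind)) hda hdb hdc
    · exact fin w (by simp) c (by simp) (by grind) hdw hdc
  · exact fin w (by simp) b (by simp) (by grind) hdw hdb
  · exact fin w (by simp) a (by simp) (by grind) hdw hda
  · exact fin w (by simp) a (by simp) (by grind) hdw hda

/-- The link is triangle-free, so some two of a, b, c are nonadjacent. -/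
theorem le_of_nonadj_link (h : Step G f x M S) (hreg : ∀ y ∈ S, degOn G S y = 5) (hv : v ∈ S)
    (hN : Nbrs G S v [w, a, b, c, d]) (hwa : ¬ G.Adj w a) (hwb : ¬ G.Adj w b)
    (hwc : ¬ G.Adj w c) : f S ≤ M := by
  have hdup := hN.1
  simp only [List.nodup_cons, List.mem_cons, List.not_mem_nil, not_or, or_false] at hdup
  have ha := (hN.2 a).1 (by simp)
  have hb := (hN.2 b).1 (by simp)
  have hc := (hN.2 c).1 (by simp)
  by_cases hab : G.Adj a b
  swap
  · exact h.le_of_nonadj_link_aux hreg hv hN hwa hwb hwc hab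
  by_cases hac : G.Adj a c
  swap
  · exact h.le_of_nonadj_link_aux hreg hv (hN.congr (l' := [w, a, c, b, d]) (by simp; grind)
      (by simp; grind)) hwa hwc hwb hac
  exact h.le_of_nonadj_link_aux hreg hv (hN.congr (l' := [w, b, c, a, d]) (by simp; grind)
    (by simp; grind)) hwb hwc hwa (h.cliqueFree v a b c ha.2 hb.2 hc.2 hab hac)

/-- In the link of `v`, the vertex `a` has the neighbours `b` and `c`. -/
theorem le_of_two_adj_link (h : Step G f x M S) (hreg : ∀ y ∈ S, degOn G S y = 5) (hv : v ∈ S)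
    (hN : Nbrs G S v [a, b, c, d, e]) (hab : G.Adj a b) (hac : G.Adj a c) : f S ≤ M := by
  have sym := G.adj_comm
  have hdup := hN.1
  simp only [List.nodup_cons, List.mem_cons, List.not_mem_nil, not_or, or_false] at hdup
  have ha := (hN.2 a).1 (by simp)
  have hb := (hN.2 b).1 (by simp)
  have hc := (hN.2 c).1 (by simp)
  by_cases had : G.Adj a d
  · exact h.le_of_three_edges_link hreg hv hN hab hac had
  by_cases hae : G.Adj a e
  · exact h.le_of_three_edges_link hreg hv (hN.congr (l' := [a, b, c, e, d]) (by simp; grind)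
      (by simp; grind)) hab hac hae
  have hbc : ¬ G.Adj b c := h.cliqueFree v a b c ha.2 hb.2 hc.2 hab hac
  -- Degree at least 3 or at most 1 in the link is already settled. What remains is a 2-regular
  -- graph on five vertices, a pentagon.
  have main : ∀ d e, Nbrs G S v [a, b, c, d, e] → ¬ G.Adj a d → ¬ G.Adj a e → G.Adj b d →
      ¬ G.Adj b e → f S ≤ M := by
    intro d e hN had hae hbd hbe
    have hdup := hN.1
    simp only [List.nodup_cons, List.mem_cons, List.not_mem_nil, not_or, or_false] at hdup
    by_cases hce : G.Adj c e
    swap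
    · exact h.le_of_nonadj_link hreg hv (hN.congr (l' := [e, a, b, c, d]) (by simp; grind)
        (by simp; grind)) (by grind) (by grind) (by grind)
    by_cases hcd : G.Adj c d
    · exact h.le_of_three_edges_link hreg hv (hN.congr (l' := [c, a, d, e, b]) (by simp; grind)
        (by simp; grind)) hac.symm hcd hce
    by_cases hde : G.Adj d e
    · exact h.le_of_pentagon_link hreg hv (hN.congr (l' := [a, e, b, c, d]) (by simp; grind)
        (by simp; grind)) hab hce.symm hbd hac hde.symm hae (by grind) hbc hcd had
    · exact h.le_of_nonadj_link hreg hv (hN.congr (l' := [d, a, c, e, b]) (by simp; grind)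
        (by simp; grind)) (by grind) (by grind) hde
  by_cases hbd : G.Adj b d <;> by_cases hbe : G.Adj b e
  · exact h.le_of_three_edges_link hreg hv (hN.congr (l' := [b, a, d, e, c]) (by simp; grind)
      (by simp; grind)) hab.symm hbd hbe
  · exact main d e hN had hae hbd hbe
  · exact main e d (hN.congr (by simp; grind) (by simp; grind)) hae had hbe hbd
  · exact h.le_of_nonadj_link hreg hv (hN.congr (l' := [b, c, d, e, a]) (by simp; grind)
      (by simp; grind)) hbc hbd hbe

/-- Among the four other neighbours of v, a has at least two neighbours or at least three
nonneighbours. -/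
theorem le_of_regular_five (h : Step G f x M S) (hreg : ∀ y ∈ S, degOn G S y = 5) (hv : v ∈ S) :
    f S ≤ M := by
  obtain ⟨l, hN, hl⟩ := exists_nbrs G S v
  rw [hreg v hv] at hl
  match l, hN, hl with
  | [a, b, c, d, e], hN, _ =>
    have hdup := hN.1
    simp only [List.nodup_cons, List.mem_cons, List.not_mem_nil, not_or, or_false] at hdup
    by_cases hab : G.Adj a b
    · by_cases hac : G.Adj a c
      · exact h.le_of_two_adj_link hreg hv hN hab hac
      by_cases had : G.Adj a d
      · exact h.le_of_two_adj_link hreg hv (hN.congr (l' := [a, b, d, c, e]) (by simp; grind)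
          (by simp; grind)) hab had
      by_cases hae : G.Adj a e
      · exact h.le_of_two_adj_link hreg hv (hN.congr (l' := [a, b, e, c, d]) (by simp; grind)
          (by simp; grind)) hab hae
      exact h.le_of_nonadj_link hreg hv (hN.congr (l' := [a, c, d, e, b]) (by simp; grind)
        (by simp; grind)) hac had hae
    by_cases hac : G.Adj a c
    · by_cases had : G.Adj a d
      · exact h.le_of_two_adj_link hreg hv (hN.congr (l' := [a, c, d, b, e]) (by simp; grind)
          (by simp; grind)) hac had
      by_cases hae : G.Adj a e
      · exact h.le_of_two_adj_link hreg hv (hN.congr (l' := [a, c, e, b, d]) (by simp; grind)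
          (by simp; grind)) hac hae
      exact h.le_of_nonadj_link hreg hv (hN.congr (l' := [a, b, d, e, c]) (by simp; grind)
        (by simp; grind)) hab had hae
    by_cases had : G.Adj a d
    · by_cases hae : G.Adj a e
      · exact h.le_of_two_adj_link hreg hv (hN.congr (l' := [a, d, e, b, c]) (by simp; grind)
          (by simp; grind)) had hae
      exact h.le_of_nonadj_link hreg hv (hN.congr (l' := [a, b, c, e, d]) (by simp; grind)
        (by simp; grind)) hab hac hae
    exact h.le_of_nonadj_link hreg hv hN hab hac had

end Step

end Branching

end SimpleGraph

/-! ### The induction, and triangle components -/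

namespace SimpleGraph

namespace Branching

open Finset

variable {V : Type u} [DecidableEq V] {G : SimpleGraph V} [DecidableRel G.Adj]
  {S : Finset V} {v : V} {f : Finset V → ℝ} {x M : ℝ}

theorem Step.le_of_nonempty (h : Step G f x M S) (hS : S.Nonempty) : f S ≤ M := by
  have irr : ∀ u v, G.Adj u v → u ≠ v := fun _ _ h => h.ne
  by_cases hlow : ∃ v ∈ S, degOn G S v ≤ 3
  · obtain ⟨v, hv, h3⟩ := hlow
    by_cases htri : TriangleOn G S v
    · obtain ⟨a, b, ha, hb, hva, hvb, hab, h1, -, -⟩ := htri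
      have hs := h.le_branchSum hv (l := [a, b]) ⟨by simp; grind, by simp; grind⟩
      simp only [branchSum, add_zero] at hs
      have da : 2 ≤ degOn G S a :=
        Step.length_le_degOn (l := [v, b]) (by simp; grind) (by simp [hv, hb, hva.symm, hab])
      have db : 2 ≤ degOn G S b :=
        Step.length_le_degOn (l := [v, a]) (by simp; grind) (by simp [hv, ha, hvb.symm, hab.symm])
      have t1 := h.le_bound (k := 3) (P := []) ha [] (by simp) (by omega) (by simp; omega)
      have t2 := h.le_bound (k := 3) (P := [a]) hb [] (by simp) (by omega) (by simp; omega)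
      have num := h.nums
      linarith
    · have := h.le_of_low ⟨v, hv, h3, htri⟩
      have num := h.nums
      linarith
  push Not at hlow
  by_cases hhigh : ∃ v ∈ S, 6 ≤ degOn G S v
  · obtain ⟨v, hv, h6⟩ := hhigh
    have hs := h.branch hv
    -- A single branching at v: the deletion loses one vertex and the link at least seven, and x +
    -- x⁷ is about 0.992.
    have t1 := h.bound (S.erase v) 1 (by rw [card_erase_add_one hv]) le_rfl
    have e : (S.filter fun y => y ≠ v ∧ ¬ G.Adj v y) = rest G S [] v := by simp [rest]
    have t2 := h.le_bound (k := 7) (P := []) hv [] (by simp) (by omega) (by simp; omega)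
    rw [e] at hs
    have num := h.nums
    rw [pow_one] at t1
    linarith
  push Not at hhigh
  by_cases h4 : ∃ v ∈ S, degOn G S v = 4
  · obtain ⟨v, hv, h4⟩ := h4
    exact h.le_of_degOn_four (fun y hy => hlow y hy) (fun y hy => Nat.le_of_lt_succ (hhigh y hy))
      hv h4
  push Not at h4
  obtain ⟨v, hv⟩ := hS
  refine h.le_of_regular_five (fun y hy => ?_) hv
  have h1 := hlow y hy
  have h2 := hhigh y hy
  have h3 := h4 y hy
  omega

/-- Both bounds are proved in one strong induction on |S|, since the general bound also relies on
the refined one for smaller sets. As θ ≥ 1, a lower bound k on the number of lost vertices is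
enough. -/
theorem IsBranching.le_pow (hf : IsBranching G f) {θ : ℝ} (hpos : 0 < θ) (hcube : θ ^ 3 = 2)
    (hfree : ∀ a b c d, G.Adj a b → G.Adj a c → G.Adj a d → G.Adj b c → G.Adj b d → ¬ G.Adj c d)
    (S : Finset V) :
    f S ≤ θ ^ S.card ∧ ((∃ v ∈ S, degOn G S v ≤ 3 ∧ ¬ TriangleOn G S v) →
      f S ≤ (θ⁻¹ ^ 4 + θ⁻¹ ^ 5 + θ⁻¹ ^ 6) * θ ^ S.card) := by
  have hθ : 1 ≤ θ := by
    by_contra hc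
    push Not at hc
    have := pow_lt_one₀ hpos.le hc (n := 3) (by norm_num)
    linarith
  induction hn : S.card using Nat.strong_induction_on generalizing S with
  | _ n ih =>
    subst hn
    have hle : ∀ (T : Finset V) k, T.card + k ≤ S.card → θ ^ T.card ≤ θ⁻¹ ^ k * θ ^ S.card := by
      intro T k hTk
      have h1 : θ⁻¹ ^ k * θ ^ S.card = θ ^ (S.card - k) := by
        rw [inv_pow, ← div_eq_inv_mul, div_eq_iff (by positivity), ← pow_add]
        congr 1
        omega
      rw [h1]
      exact pow_le_pow_right₀ hθ (by omega)
    have hstep : Step G f θ⁻¹ (θ ^ S.card) S :=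
      { hf with
        pos := by positivity
        cube := by rw [inv_pow, hcube]; norm_num
        nonneg := by positivity
        cliqueFree := hfree
        bound := fun T k hTk hk => (ih _ (by omega) T rfl).1.trans (hle T k hTk)
        boundLow := fun T k hTk hk hlow => ((ih _ (by omega) T rfl).2 hlow).trans
          (mul_le_mul_of_nonneg_left (hle T k hTk) (by positivity)) }
    refine ⟨?_, hstep.le_of_low⟩
    rcases S.eq_empty_or_nonempty with rfl | hS
    · simpa using hf.empty_le
    · exact hstep.le_of_nonempty hS

/-- The set {v, a, b} is closed under adjacency, so walks from v stay in it and it is the whole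
component. -/
theorem TriangleOn.inTriangleComponent {W : Type*} [Fintype W] {G : SimpleGraph W} {v : W}
    (h : TriangleOn G univ v) :
    G.InTriangleComponent v := by
  classical
  obtain ⟨a, b, -, -, hva, hvb, hab, h1, h2, h3⟩ := h
  have hreach : ∀ {y z : W}, G.Walk y z → (y = v ∨ y = a ∨ y = b) → (z = v ∨ z = a ∨ z = b) := by
    intro y z p
    induction p with
    | nil => exact id
    | @cons y w z hyw _ ih =>
      intro hy
      apply ih
      rcases hy with rfl | rfl | rfl
      · exact Or.inr (h1 w (mem_univ w) hyw)
      · rcases h2 w (mem_univ w) hyw with h | h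
        · exact Or.inl h
        · exact Or.inr (Or.inr h)
      · rcases h3 w (mem_univ w) hyw with h | h
        · exact Or.inl h
        · exact Or.inr (Or.inl h)
  have hmem : ∀ y, y ∈ G.connectedComponentMk v ↔ y = v ∨ y = a ∨ y = b := by
    intro y
    change G.connectedComponentMk y = G.connectedComponentMk v ↔ _
    rw [ConnectedComponent.eq]
    constructor
    · rintro ⟨p⟩
      exact hreach p.reverse (Or.inl rfl)
    · rintro (rfl | rfl | rfl)
      · exact Reachable.refl _
      · exact hva.symm.reachable
      · exact hvb.symm.reachable
  have htop : (G.connectedComponentMk v).toSimpleGraph = ⊤ := by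
    ext ⟨y, hy⟩ ⟨z, hz⟩
    rw [ConnectedComponent.toSimpleGraph_adj, top_adj, ne_eq, Subtype.mk.injEq]
    have hy' := (hmem y).1 hy
    have hz' := (hmem z).1 hz
    refine ⟨fun h => h.ne, fun hne => ?_⟩
    rcases hy' with rfl | rfl | rfl <;> rcases hz' with rfl | rfl | rfl <;>
      first | exact absurd rfl hne | assumption | (apply Adj.symm; assumption)
  have hcard : Nat.card (G.connectedComponentMk v) = 3 := by
    have e : (↑(G.connectedComponentMk v) : Set W) = (({v, a, b} : Finset W) : Set W) := by
      ext y
      simpa using hmem y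
    have : Nat.card (G.connectedComponentMk v) =
        Set.ncard (↑(G.connectedComponentMk v) : Set W) := rfl
    rw [this, e, Set.ncard_coe_finset, card_eq_three]
    exact ⟨v, a, b, hva.ne, hvb.ne, hab.ne, rfl⟩
  have hfin : Finite (G.connectedComponentMk v) := Nat.finite_of_card_ne_zero (by omega)
  obtain ⟨e⟩ : Nonempty (G.connectedComponentMk v ≃ Fin 3) :=
    ⟨(Finite.equivFin _).trans (finCongr hcard)⟩
  rw [InTriangleComponent, htop]
  exact ⟨Iso.completeGraph e⟩

end Branching

/-! ### Application to independence and clique complexes -/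

open Branching Finset

variable (𝕜 : Type v) [Field 𝕜] {V : Type u} [Fintype V] [LinearOrder V] (G : SimpleGraph V)

theorem isBranching_bettiOn [DecidableRel G.Adj] : IsBranching G (G.bettiOn 𝕜) where
  empty_le := G.bettiOn_empty_le 𝕜
  isolated hv h := G.bettiOn_nonpos 𝕜 hv h
  branch hu := G.bettiOn_le 𝕜 hu

theorem cliqueComplex_eq_indepComplex_compl {W : Type*} (G : SimpleGraph W) :
    G.cliqueComplex = Gᶜ.indepComplex := by
  simp only [cliqueComplex, indepComplex, isIndepSet_compl]

theorem not_adj_of_not_isIndContained {W : Type*} {G : SimpleGraph W}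
    (h : ¬ (⊤ : SimpleGraph (Fin 4)).IsIndContained G) (a b c d : W) (hab : G.Adj a b) (hac : G.Adj a c) (had : G.Adj a d) (hbc : G.Adj b c)
    (hbd : G.Adj b d) : ¬ G.Adj c d := by
  classical
  intro hcd
  have hcl : G.IsNClique 4 {a, b, c, d} := by
    rw [isNClique_iff]
    refine ⟨?_, ?_⟩
    · simp [isClique_insert, hab, hac, had, hbc, hbd, hcd]
    · rw [card_eq_succ]
      exact ⟨a, {b, c, d}, by simp [hab.ne, hac.ne, had.ne], rfl,
        card_eq_three.2 ⟨b, c, d, hbc.ne, hbd.ne, hcd.ne, rfl⟩⟩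
  have hn : ¬ G.CliqueFree 4 := fun hf => hf _ hcl
  exact h ⟨topEmbeddingOfNotCliqueFree hn⟩

end SimpleGraph

theorem bigTheta_two_pos : 0 < bigTheta 2 := by
  rw [bigTheta]
  positivity

theorem bigTheta_two_cube : bigTheta 2 ^ 3 = 2 := by
  rw [bigTheta, ← Real.rpow_natCast, ← Real.rpow_mul (by norm_num)]
  norm_num

theorem bigTheta_two_pow (n : ℕ) : bigTheta 2 ^ n = (2 : ℝ) ^ ((n : ℝ) / 3) := by
  rw [bigTheta, ← Real.rpow_natCast, ← Real.rpow_mul (by norm_num)]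
  congr 1
  push_cast
  ring

theorem theoremt (𝕜 : Type v) [Field 𝕜] :
    (∀ (V : Type u) [Fintype V] [LinearOrder V] (G : SimpleGraph V) [DecidableRel G.Adj] (n : ℕ),
      Fintype.card V = n → ¬ (⊤ : SimpleGraph (Fin 4)).IsIndContained G →
        ((G.indepBetti 𝕜 : ℝ) ≤ bigTheta 2 ^ n ∧
          bigTheta 2 ^ n = (2 : ℝ) ^ ((n : ℝ) / 3)) ∧
        ((∃ v : V, G.degree v ≤ 3 ∧ ¬ G.InTriangleComponent v) →
          (G.indepBetti 𝕜 : ℝ) ≤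
            (bigTheta 2 ^ (-4 : ℤ) + bigTheta 2 ^ (-5 : ℤ) + bigTheta 2 ^ (-6 : ℤ)) *
              bigTheta 2 ^ n)) ∧
    (∀ n : ℕ, (SimpleGraph.maxCliqueBetti 𝕜 (⊥ : SimpleGraph (Fin 4)) n : ℝ) ≤
      (2 : ℝ) ^ ((n : ℝ) / 3)) := by
  constructor
  · intro V _ _ G _ n hn hfree
    have key := (G.isBranching_bettiOn 𝕜).le_pow bigTheta_two_pos bigTheta_two_cube
      (SimpleGraph.not_adj_of_not_isIndContained hfree) Finset.univ
    rw [Finset.card_univ, hn] at key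
    rw [SimpleGraph.indepBetti_eq_bettiOn]
    refine ⟨⟨key.1, bigTheta_two_pow n⟩, ?_⟩
    rintro ⟨v, hdeg, htri⟩
    have h := key.2 ⟨v, Finset.mem_univ v, ?_, fun ht => htri ht.inTriangleComponent⟩
    · simpa only [zpow_neg, zpow_ofNat, inv_pow] using h
    · rwa [SimpleGraph.Branching.degOn, ← SimpleGraph.neighborFinset_eq_filter,
        SimpleGraph.card_neighborFinset_eq_degree]
  · intro n
    classical
    -- The maximum is a supremum of natural numbers, so the real bound is first replaced by its
    -- floor.
    have hle : SimpleGraph.maxCliqueBetti 𝕜 (⊥ : SimpleGraph (Fin 4)) n ≤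
        ⌊(2 : ℝ) ^ ((n : ℝ) / 3)⌋₊ := by
      refine Finset.sup_le fun G hG => Nat.le_floor ?_
      rw [Finset.mem_filter] at hG
      obtain ⟨m, G⟩ := G
      -- Complementation exchanges induced copies of I₄ in G with induced copies of K₄ in the
      -- complement, and cliques with independent sets.
      have hfree : ¬ (⊤ : SimpleGraph (Fin 4)).IsIndContained Gᶜ := fun h => hG.2 (by
        have := h.compl
        rwa [compl_top, compl_compl] at this)
      have key := ((Gᶜ.isBranching_bettiOn 𝕜).le_pow bigTheta_two_pos bigTheta_two_cube
        (SimpleGraph.not_adj_of_not_isIndContained hfree) Finset.univ).1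
      rw [Finset.card_univ, Fintype.card_fin, bigTheta_two_pow,
        ← SimpleGraph.indepBetti_eq_bettiOn] at key
      rw [SimpleGraph.cliqueComplex_eq_indepComplex_compl]
      refine key.trans (Real.rpow_le_rpow_of_exponent_le (by norm_num) ?_)
      have : ((m : ℕ) : ℝ) ≤ n := by exact_mod_cast Nat.le_of_lt_succ m.2
      linarith
    exact (Nat.cast_le.2 hle).trans (Nat.floor_le (by positivity))
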